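/- Let $\mu>0$ and $\eta\in(0,2)$, and put $\alpha_0=\mu$ if $\mu<2$, $\alpha_0=2-\eta$ if $\mu=2$, and $\alpha_0=2$ if $\mu>2$. Consider, for real-valued $u$ on $\mathbb R^n$, $n\ge 1$, the problem $$\partial_t^2u-\Delta u+\frac{\mu}{1+t}\,\partial_tu=0\quad(t>0),\qquad u(0)=u_0,\quad \partial_tu(0)=u_1. \tag{1}$$ Write $H^k=H^k(\mathbb R^n)$ with norm $\|f\|_{H^k}=\sum_{\ell=0}^k\|\partial_x^\ell f\|_{L^2}$. A strong solution of (1), for data in $H^2\times H^1$, is a function $u\in C([0,\infty),H^2)\cap C^1([0,\infty),H^1)\cap C^2([0,\infty),L^2)$ with these initial data that satisfies the equation in $L^2$. A mild solution of (1), for data $(u_0,u_1)\in H^1\times L^2$, is a function $u\in C([0,\infty),H^1)\cap C^1([0,\infty),L^2)$ that is the limit, in $C([0,T],H^1)\cap C^1([0,T],L^2)$ for every $T>0$, of a sequence of strong solutions $u^{(j)}$ whose data converge to $(u_0,u_1)$ in $H^1\times L^2$. There is a constant $C>0$ depending only on $\mu$ and $\eta$ such that for every $n\ge1$ and all $(u_0,u_1)\in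 H^1\times L^2$ the following holds. There is a unique mild solution $u\in C([0,\infty),H^1)\cap C^1([0,\infty),L^2)$ of (1); every sequence of strong solutions whose data converge to $(u_0,u_1)$ in $H^1\times L^2$ converges to $u$ in the above sense; and for all $t\ge s\ge0$ $$\frac{\|u(t)\|_{L^2}^2}{(1+t)^2}+\|\partial_tu(t)\|_{L^2}^2+\|\nabla u(t)\|_{L^2}^2\le C\Big(\frac{1+s}{1+t}\Big)^{\alpha_0}\Big(\frac{\|u(s)\|_{L^2}^2}{(1+s)^2}+\|\partial_tu(s)\|_{L^2}^2+\|\nabla u(s)\|_{L^2}^2\Big).$$ If $(u_0,u_1)\in H^2\times H^1$, then $u$ is a strong solution and for all $t\ge s\ge0$ $$\|\nabla\partial_tu(t)\|_{L^2}^2+\|\Delta u(t)\|_{L^2}^2\le C\Big(\frac{1+s}{1+t}\Big)^{\alpha_0}\big(\|\nabla\partial_tu(s)\|_{L^2}^2+\|\nabla u(s)\|_{H^1}^2\big).$$ If $(u_0,u_1)\in H^3\times H^2$, then $u\in C([0,\infty),H^3)\cap C^1([0,\infty),H^2)$ and for all $t\ge s\ge0$ $$\|\partial_t\Delta u(t)\|_{L^2}^2+\|\nabla\Delta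 u(t)\|_{L^2}^2\le C\Big(\frac{1+s}{1+t}\Big)^{\alpha_0}\big(\|\partial_t\Delta u(s)\|_{L^2}^2+\|\Delta u(s)\|_{H^1}^2\big).$$ -/

import Mathlib

open MeasureTheory Filter Topology Set
open scoped ContDiff

noncomputable section

/-- The Euclidean space `ℝⁿ`. -/
abbrev Space (n : ℕ) := EuclideanSpace ℝ (Fin n)

/-- The real Lebesgue space `L²(ℝⁿ)`. -/
abbrev L2 (n : ℕ) : Type := Lp ℝ 2 (volume : Measure (Space n))

variable {n : ℕ}

/-- `g ∈ L²` is the weak partial derivative `∂ᵢ f` of `f ∈ L²`, tested against `C_c^∞(ℝⁿ)`. -/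
def HasWeakDeriv (i : Fin n) (f g : L2 n) : Prop :=
  ∀ φ : Space n → ℝ, ContDiff ℝ ∞ φ → HasCompactSupport φ →
    ∫ x, f x * fderiv ℝ φ x (EuclideanSpace.single i 1) = -∫ x, g x * φ x

theorem L2.integrable_mul_test (f : L2 n) {φ : Space n → ℝ} (hφ : Continuous φ)
    (hc : HasCompactSupport φ) : Integrable (fun x => f x * φ x) :=
  MemLp.integrable_mul (p := 2) (q := 2) (Lp.memLp f) (hφ.memLp_of_hasCompactSupport hc)

theorem continuous_partial {φ : Space n → ℝ} (hφ : ContDiff ℝ ∞ φ) (v : Space n) :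
    Continuous (fun x => fderiv ℝ φ x v) :=
  (hφ.continuous_fderiv (by simp)).clm_apply continuous_const

theorem hasCompactSupport_partial {φ : Space n → ℝ} (hc : HasCompactSupport φ) (v : Space n) :
    HasCompactSupport (fun x => fderiv ℝ φ x v) :=
  hc.fderiv_apply ℝ v

theorem HasWeakDeriv.zero (i : Fin n) : HasWeakDeriv i (0 : L2 n) 0 := by
  intro φ _ _
  have h : ∀ ψ : Space n → ℝ, ∫ x, (0 : L2 n) x * ψ x = 0 := by
    intro ψ
    rw [integral_eq_zero_of_ae]
    filter_upwards [Lp.coeFn_zero ℝ 2 (volume : Measure (Space n))] with x hx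
    rw [hx, Pi.zero_apply, zero_mul]
  rw [h, h, neg_zero]

theorem HasWeakDeriv.add {i : Fin n} {f f' g g' : L2 n} (h : HasWeakDeriv i f g)
    (h' : HasWeakDeriv i f' g') : HasWeakDeriv i (f + f') (g + g') := by
  intro φ hφ hc
  have key : ∀ (a b : L2 n) (ψ : Space n → ℝ), Continuous ψ → HasCompactSupport ψ →
      ∫ x, (a + b : L2 n) x * ψ x = (∫ x, a x * ψ x) + ∫ x, b x * ψ x := by
    intro a b ψ hψ hψc
    rw [← integral_add (L2.integrable_mul_test a hψ hψc) (L2.integrable_mul_test b hψ hψc)]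
    apply integral_congr_ae
    filter_upwards [Lp.coeFn_add a b] with x hx
    rw [hx, Pi.add_apply, add_mul]
  rw [key f f' _ (continuous_partial hφ _) (hasCompactSupport_partial hc _),
    key g g' _ hφ.continuous hc, h φ hφ hc, h' φ hφ hc]
  ring

theorem HasWeakDeriv.smul {i : Fin n} {f g : L2 n} (c : ℝ) (h : HasWeakDeriv i f g) :
    HasWeakDeriv i (c • f) (c • g) := by
  intro φ hφ hc
  have key : ∀ (a : L2 n) (ψ : Space n → ℝ),
      ∫ x, (c • a : L2 n) x * ψ x = c * ∫ x, a x * ψ x := by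
    intro a ψ
    rw [← integral_const_mul]
    apply integral_congr_ae
    filter_upwards [Lp.coeFn_smul c a] with x hx
    rw [hx, Pi.smul_apply, smul_eq_mul, mul_assoc]
  rw [key, key, h φ hφ hc]
  ring

theorem HasWeakDeriv.unique {i : Fin n} {f g g' : L2 n} (h : HasWeakDeriv i f g)
    (h' : HasWeakDeriv i f g') : g = g' := by
  apply Lp.ext
  apply ae_eq_of_integral_contDiff_smul_eq
  · exact (Lp.memLp g).locallyIntegrable (by norm_num)
  · exact (Lp.memLp g').locallyIntegrable (by norm_num)
  · intro φ hφ hc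
    have := (h φ hφ hc).symm.trans (h' φ hφ hc)
    simpa [mul_comm] using this

open Classical in
/-- The weak partial derivative `∂ᵢ f ∈ L²`; it is `0` by convention if there is none in `L²`. -/
def weakDeriv (i : Fin n) (f : L2 n) : L2 n :=
  if h : ∃ g, HasWeakDeriv i f g then h.choose else 0

theorem HasWeakDeriv.weakDeriv_eq {i : Fin n} {f g : L2 n} (h : HasWeakDeriv i f g) :
    weakDeriv i f = g := by
  have hex : ∃ g, HasWeakDeriv i f g := ⟨g, h⟩
  rw [weakDeriv, dif_pos hex]
  exact hex.choose_spec.unique h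

/-- The Sobolev space `H^k(ℝⁿ)`: all weak derivatives of order at most `k` exist and lie in `L²`,
that is, `H⁰ = L²`, and `f ∈ H^{k+1}` iff `f ∈ L²` and `∂ᵢ f ∈ H^k` for all `i`. -/
def sobolev (n : ℕ) : ℕ → Submodule ℝ (L2 n)
  | 0 => ⊤
  | k + 1 =>
    { carrier := {f | ∀ i, ∃ g ∈ sobolev n k, HasWeakDeriv i f g}
      zero_mem' := fun i => ⟨0, zero_mem _, HasWeakDeriv.zero i⟩
      add_mem' := fun {a b} ha hb i => by
        obtain ⟨g, hg, hag⟩ := ha i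
        obtain ⟨g', hg', hbg⟩ := hb i
        exact ⟨g + g', add_mem hg hg', hag.add hbg⟩
      smul_mem' := fun c a ha i => by
        obtain ⟨g, hg, hag⟩ := ha i
        exact ⟨c • g, Submodule.smul_mem _ c hg, hag.smul c⟩ }

/-- The iterated weak derivative `∂_{α(ℓ-1)} ⋯ ∂_{α(0)} f` of order `ℓ`. -/
def multiDeriv : (ℓ : ℕ) → (Fin ℓ → Fin n) → L2 n → L2 n
  | 0, _, f => f
  | ℓ + 1, α, f => multiDeriv ℓ (Fin.tail α) (weakDeriv (α 0) f)

/-- `‖∂ₓ^ℓ f‖_{L²}`, the `L²` norm of the tensor of all partial derivatives of order `ℓ`.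
In particular `derivNorm 1 f = ‖∇ f‖_{L²}`. -/
def derivNorm (ℓ : ℕ) (f : L2 n) : ℝ :=
  √(∑ α : Fin ℓ → Fin n, ‖multiDeriv ℓ α f‖ ^ 2)

/-- The Sobolev norm `‖f‖_{H^k} = ∑_{ℓ ≤ k} ‖∂ₓ^ℓ f‖_{L²}` (meaningful for `f ∈ H^k`). -/
def sobolevNorm (k : ℕ) (f : L2 n) : ℝ :=
  ∑ ℓ ∈ Finset.range (k + 1), derivNorm ℓ f

/-- `‖∇ f‖_{H^k} = ∑_{ℓ ≤ k} ‖∂ₓ^ℓ ∇ f‖_{L²}` (meaningful for `f ∈ H^{k+1}`). -/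
def gradSobolevNorm (k : ℕ) (f : L2 n) : ℝ :=
  ∑ ℓ ∈ Finset.range (k + 1), derivNorm (ℓ + 1) f

/-- The weak Laplacian `Δ f = ∑ᵢ ∂ᵢ ∂ᵢ f` (meaningful for `f ∈ H²`). -/
def laplacian (f : L2 n) : L2 n :=
  ∑ i : Fin n, weakDeriv i (weakDeriv i f)

theorem multiDeriv_add {k : ℕ} : ∀ {ℓ : ℕ}, ℓ ≤ k → ∀ (α : Fin ℓ → Fin n) {f g : L2 n},
    f ∈ sobolev n k → g ∈ sobolev n k →
    multiDeriv ℓ α (f + g) = multiDeriv ℓ α f + multiDeriv ℓ α g := by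
  induction k with
  | zero =>
    intro ℓ hℓ α f g _ _
    obtain rfl : ℓ = 0 := by omega
    rfl
  | succ k ih =>
    intro ℓ hℓ α f g hf hg
    cases ℓ with
    | zero => rfl
    | succ ℓ =>
      obtain ⟨f', hf', hff⟩ := hf (α 0)
      obtain ⟨g', hg', hgg⟩ := hg (α 0)
      simp only [multiDeriv]
      rw [(hff.add hgg).weakDeriv_eq, hff.weakDeriv_eq, hgg.weakDeriv_eq]
      exact ih (by omega) _ hf' hg'

theorem multiDeriv_smul {k : ℕ} (c : ℝ) : ∀ {ℓ : ℕ}, ℓ ≤ k → ∀ (α : Fin ℓ → Fin n) {f : L2 n},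
    f ∈ sobolev n k → multiDeriv ℓ α (c • f) = c • multiDeriv ℓ α f := by
  induction k with
  | zero =>
    intro ℓ hℓ α f _
    obtain rfl : ℓ = 0 := by omega
    rfl
  | succ k ih =>
    intro ℓ hℓ α f hf
    cases ℓ with
    | zero => rfl
    | succ ℓ =>
      obtain ⟨f', hf', hff⟩ := hf (α 0)
      simp only [multiDeriv]
      rw [(hff.smul c).weakDeriv_eq, hff.weakDeriv_eq]
      exact ih (by omega) _ hf'

theorem derivNorm_eq_norm (ℓ : ℕ) (f : L2 n) :
    derivNorm ℓ f = ‖WithLp.toLp 2 (fun α : Fin ℓ → Fin n => multiDeriv ℓ α f)‖ := by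
  rw [PiLp.norm_eq_of_L2]
  rfl

theorem derivNorm_nonneg (ℓ : ℕ) (f : L2 n) : 0 ≤ derivNorm ℓ f := Real.sqrt_nonneg _

theorem derivNorm_zero (f : L2 n) : derivNorm 0 f = ‖f‖ := by
  simp [derivNorm, multiDeriv]

theorem derivNorm_add {k ℓ : ℕ} (hℓ : ℓ ≤ k) {f g : L2 n} (hf : f ∈ sobolev n k)
    (hg : g ∈ sobolev n k) : derivNorm ℓ (f + g) ≤ derivNorm ℓ f + derivNorm ℓ g := by
  simp only [derivNorm_eq_norm]
  refine le_trans (le_of_eq ?_) (norm_add_le _ _)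
  congr 1
  ext1 α
  exact multiDeriv_add hℓ α hf hg

theorem derivNorm_smul {k ℓ : ℕ} (hℓ : ℓ ≤ k) (c : ℝ) {f : L2 n} (hf : f ∈ sobolev n k) :
    derivNorm ℓ (c • f) = |c| * derivNorm ℓ f := by
  simp only [derivNorm_eq_norm]
  rw [← Real.norm_eq_abs, ← norm_smul]
  congr 1
  ext1 α
  exact multiDeriv_smul c hℓ α hf

theorem norm_le_sobolevNorm (k : ℕ) (f : L2 n) : ‖f‖ ≤ sobolevNorm k f := by
  rw [← derivNorm_zero]
  exact Finset.single_le_sum (f := fun ℓ => derivNorm ℓ f)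
    (fun ℓ _ => derivNorm_nonneg ℓ f) (Finset.mem_range.2 (Nat.succ_pos k))

/-- `H^k(ℝⁿ)` as a type of its own, to carry the norm of `H^k` (and not that of `L²`). -/
def SobolevSpace (n k : ℕ) : Type := sobolev n k

namespace SobolevSpace

variable {k : ℕ}

instance : AddCommGroup (SobolevSpace n k) := inferInstanceAs (AddCommGroup (sobolev n k))

instance : Module ℝ (SobolevSpace n k) := inferInstanceAs (Module ℝ (sobolev n k))

/-- The inclusion of `H^k` in `L²`. -/
def toL2 : SobolevSpace n k →ₗ[ℝ] L2 n := (sobolev n k).subtype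

theorem toL2_mem (f : SobolevSpace n k) : toL2 f ∈ sobolev n k := Subtype.property f

theorem toL2_injective : Function.Injective (toL2 : SobolevSpace n k → L2 n) :=
  Subtype.val_injective

instance : Norm (SobolevSpace n k) := ⟨fun f => sobolevNorm k (toL2 f)⟩

theorem norm_def (f : SobolevSpace n k) : ‖f‖ = sobolevNorm k (toL2 f) := rfl

theorem core : NormedSpace.Core ℝ (SobolevSpace n k) where
  norm_nonneg f := show 0 ≤ sobolevNorm k (toL2 f) from
    Finset.sum_nonneg fun ℓ _ => derivNorm_nonneg ℓ _
  norm_smul c f := by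
    simp only [norm_def, sobolevNorm, map_smul, Finset.mul_sum, Real.norm_eq_abs]
    exact Finset.sum_congr rfl fun ℓ hℓ =>
      derivNorm_smul (Nat.lt_succ_iff.1 (Finset.mem_range.1 hℓ)) c (toL2_mem f)
  norm_triangle f g := by
    simp only [norm_def, sobolevNorm, map_add, ← Finset.sum_add_distrib]
    exact Finset.sum_le_sum fun ℓ hℓ =>
      derivNorm_add (Nat.lt_succ_iff.1 (Finset.mem_range.1 hℓ)) (toL2_mem f) (toL2_mem g)
  norm_eq_zero_iff f := by
    constructor
    · intro h
      apply toL2_injective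
      rw [map_zero, ← norm_le_zero_iff]
      exact (norm_le_sobolevNorm k _).trans h.le
    · rintro rfl
      have h : sobolevNorm k (0 : L2 n) = 0 := by
        apply Finset.sum_eq_zero
        intro ℓ hℓ
        have := derivNorm_smul (Nat.lt_succ_iff.1 (Finset.mem_range.1 hℓ)) 0
          (zero_mem (sobolev n k))
        simpa using this
      rw [norm_def, map_zero, h]

instance : NormedAddCommGroup (SobolevSpace n k) := NormedAddCommGroup.ofCore core

instance : NormedSpace ℝ (SobolevSpace n k) := NormedSpace.ofCore core

end SobolevSpace

/-- `u ∈ C^m([0,∞), H^k(ℝⁿ))`, with one-sided derivatives at `0`. Functions of time are total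
functions on `ℝ`, of which only the values on `[0,∞)` matter. -/
def InC (m k : ℕ) (u : ℝ → L2 n) : Prop :=
  ∃ U : ℝ → SobolevSpace n k,
    ContDiffOn ℝ m U (Ici 0) ∧ ∀ t, 0 ≤ t → SobolevSpace.toL2 (U t) = u t

/-- The time derivative `∂ₜ u(t)`, in the norm of `L²`, of a function on `[0,∞)`. -/
def dt (u : ℝ → L2 n) (t : ℝ) : L2 n := derivWithin u (Ici 0) t

/-- `u` is a strong solution of `∂ₜ²u - Δu + μ/(1+t) ∂ₜu = 0` with data `(u₀, u₁)`; the
regularity forces `u₀ ∈ H²` and `u₁ ∈ H¹`. -/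
structure IsStrongSolution (μ : ℝ) (u₀ u₁ : L2 n) (u : ℝ → L2 n) : Prop where
  mem_C0_H2 : InC 0 2 u
  mem_C1_H1 : InC 1 1 u
  mem_C2_L2 : InC 2 0 u
  init : u 0 = u₀
  init_dt : dt u 0 = u₁
  equation : ∀ t, 0 < t → dt (dt u) t - laplacian (u t) + (μ / (1 + t)) • dt u t = 0

/-- `w j` are strong solutions whose data converge to `(u₀, u₁)` in `H¹ × L²`. -/
structure IsApproximation (μ : ℝ) (u₀ u₁ : L2 n) (w : ℕ → ℝ → L2 n) : Prop where
  strong : ∀ j, IsStrongSolution μ (w j 0) (dt (w j) 0) (w j)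
  data : Tendsto (fun j => sobolevNorm 1 (w j 0 - u₀)) atTop (𝓝 0)
  data_dt : Tendsto (fun j => ‖dt (w j) 0 - u₁‖) atTop (𝓝 0)

/-- `w j → u` in `C([0,T], H¹) ∩ C¹([0,T], L²)` for every `T > 0`. -/
def ConvergesInEnergy (w : ℕ → ℝ → L2 n) (u : ℝ → L2 n) : Prop :=
  ∀ T > 0, TendstoUniformlyOn
    (fun j t => sobolevNorm 1 (w j t - u t) + ‖dt (w j) t - dt u t‖) 0 atTop (Icc 0 T)

/-- `u` is a mild (generalized) solution with data `(u₀, u₁) ∈ H¹ × L²`: it is the limit in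
`C([0,∞), H¹) ∩ C¹([0,∞), L²)` of strong solutions whose data converge to `(u₀, u₁)`. -/
structure IsMildSolution (μ : ℝ) (u₀ u₁ : L2 n) (u : ℝ → L2 n) : Prop where
  data_mem : u₀ ∈ sobolev n 1
  mem_C0_H1 : InC 0 1 u
  mem_C1_L2 : InC 1 0 u
  limit : ∃ w, IsApproximation μ u₀ u₁ w ∧ ConvergesInEnergy w u

/-- The decay exponent `α₀`. -/
def alpha0 (μ η : ℝ) : ℝ :=
  if μ < 2 then μ else if μ = 2 then 2 - η else 2

end

noncomputable section
variable {n : ℕ}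

/-! Everything rests on one energy identity. Write τ = 1+t and v = ∂ₜu, put γ = α(1+μ-α)/2 and
consider τ^α (‖v‖² + ‖∇u‖² + (α/τ)⟨u,v⟩ + (γ/τ²)‖u‖²). Differentiated along the equation, the ‖∇u‖²
terms cancel because the cross term carries the factor α, and the ⟨u,v⟩ terms cancel by the choice
of γ. What is left is τ^(α-1) ((2α-2μ)‖v‖² + γ(α-2)‖u‖²/τ²), which is nonpositive for 0 ≤ α ≤
min(μ,2) (`modifiedEnergy_antitoneOn`). The bracket is comparable with the weighted energy once α²/4
< γ (`modifiedEnergy_equiv`), which for α > 0 means 3α < 2(1+μ). The choice α = min(μ,2) satisfies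
this except at μ = 2, where equality holds and η has to be given up (`alpha0_bounds`). The resulting
decay, `exists_energy_decay`, has a constant independent of the dimension.

Since the coefficients depend on time only, ∂ᵢu and Δu solve the same equation. Summing the energy
estimates of the ∂ᵢu gives the second order bound, because ‖Δu‖ ≤ ‖∂ₓ²u‖; the energy estimate of Δu
gives the third order one.

For existence, cutting frequencies off at |ξ| ≤ R turns the equation into a linear ODE with bounded
coefficients on the Fourier side (`exists_hasDerivAt_linear`). Its solutions lie in every H^k, and
their data converge to the given data in each H^(k+1) × H^k containing them. The energy estimate for
differences, and for derivatives of differences, makes the solutions Cauchy uniformly on [0,T]. The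
limit is u, and all decay estimates pass from the smooth approximations to it. The same estimate for
differences shows that any two approximating sequences have the same limit, hence uniqueness.

The calculus of weak derivatives used here (they commute, they integrate by parts) comes from
Plancherel: g = ∂ᵢf in L² exactly when the Fourier transforms satisfy ĝ = 2πi ξᵢ f̂. -/

/-! ### Sobolev spaces: norms, bounded operators, completeness. -/

theorem sobolev_succ_le (k : ℕ) : sobolev n (k + 1) ≤ sobolev n k := by
  induction k with
  | zero => exact fun _ _ => Submodule.mem_top
  | succ k ih =>
    intro f hf i
    obtain ⟨g, hg, h⟩ := hf i
    exact ⟨g, ih hg, h⟩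

theorem sobolev_mono {j k : ℕ} (h : j ≤ k) : sobolev n k ≤ sobolev n j := by
  induction h with
  | refl => exact le_rfl
  | step _ ih => exact (sobolev_succ_le _).trans ih

theorem hasWeakDeriv_weakDeriv {k : ℕ} {f : L2 n} (hf : f ∈ sobolev n (k + 1)) (i : Fin n) :
    HasWeakDeriv i f (weakDeriv i f) := by
  obtain ⟨g, _, h⟩ := hf i
  rwa [h.weakDeriv_eq]

theorem weakDeriv_mem_sobolev {k : ℕ} {f : L2 n} (hf : f ∈ sobolev n (k + 1)) (i : Fin n) :
    weakDeriv i f ∈ sobolev n k := by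
  obtain ⟨g, hg, h⟩ := hf i
  rwa [h.weakDeriv_eq]

/-- Split off the first index of a multi-index. The squares add up exactly, so estimates for the ∂ᵢf
can be summed without a loss depending on n. -/
theorem derivNorm_succ_sq (ℓ : ℕ) (f : L2 n) :
    derivNorm (ℓ + 1) f ^ 2 = ∑ i, derivNorm ℓ (weakDeriv i f) ^ 2 := by
  have h : ∀ (m : ℕ) (g : L2 n), derivNorm m g ^ 2 = ∑ α : Fin m → Fin n, ‖multiDeriv m α g‖ ^ 2 :=
    fun m g => Real.sq_sqrt (Finset.sum_nonneg fun _ _ => sq_nonneg _)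
  simp only [h]
  rw [← Fintype.sum_prod_type', ← (Fin.consEquiv fun _ => Fin n).sum_comp]
  rfl

theorem derivNorm_one_sq (f : L2 n) : derivNorm 1 f ^ 2 = ∑ i, ‖weakDeriv i f‖ ^ 2 := by
  simp [derivNorm_succ_sq, derivNorm_zero]

theorem derivNorm_succ_le (ℓ : ℕ) (f : L2 n) :
    derivNorm (ℓ + 1) f ≤ ∑ i, derivNorm ℓ (weakDeriv i f) := by
  refine le_of_sq_le_sq ?_ (Finset.sum_nonneg fun i _ => derivNorm_nonneg _ _)
  rw [derivNorm_succ_sq]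
  exact Finset.sum_sq_le_sq_sum_of_nonneg fun i _ => derivNorm_nonneg _ _

theorem derivNorm_weakDeriv_le (ℓ : ℕ) (f : L2 n) (i : Fin n) :
    derivNorm ℓ (weakDeriv i f) ≤ derivNorm (ℓ + 1) f := by
  refine le_of_sq_le_sq ?_ (derivNorm_nonneg _ _)
  rw [derivNorm_succ_sq]
  exact Finset.single_le_sum (f := fun i => derivNorm ℓ (weakDeriv i f) ^ 2)
    (fun _ _ => sq_nonneg _) (Finset.mem_univ i)

theorem sobolevNorm_nonneg (k : ℕ) (f : L2 n) : 0 ≤ sobolevNorm k f :=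
  Finset.sum_nonneg fun _ _ => derivNorm_nonneg _ _

theorem sobolevNorm_zero (f : L2 n) : sobolevNorm 0 f = ‖f‖ := by
  simp [sobolevNorm, derivNorm_zero]

theorem derivNorm_le_sobolevNorm {ℓ k : ℕ} (h : ℓ ≤ k) (f : L2 n) :
    derivNorm ℓ f ≤ sobolevNorm k f :=
  Finset.single_le_sum (f := fun ℓ => derivNorm ℓ f)
    (fun ℓ _ => derivNorm_nonneg ℓ f) (Finset.mem_range.2 (Nat.lt_succ_of_le h))

theorem sobolevNorm_le_succ (k : ℕ) (f : L2 n) : sobolevNorm k f ≤ sobolevNorm (k + 1) f := by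
  rw [sobolevNorm, sobolevNorm, Finset.sum_range_succ _ (k + 1)]
  exact le_add_of_nonneg_right (derivNorm_nonneg _ _)

theorem sobolevNorm_weakDeriv_le (k : ℕ) (f : L2 n) (i : Fin n) :
    sobolevNorm k (weakDeriv i f) ≤ sobolevNorm (k + 1) f := by
  rw [sobolevNorm, sobolevNorm, Finset.sum_range_succ' _ (k + 1)]
  exact le_add_of_le_of_nonneg (Finset.sum_le_sum fun ℓ _ => derivNorm_weakDeriv_le ℓ f i)
    (derivNorm_nonneg _ _)

theorem sobolevNorm_succ_le (k : ℕ) (f : L2 n) :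
    sobolevNorm (k + 1) f ≤ ‖f‖ + ∑ i, sobolevNorm k (weakDeriv i f) := by
  simp only [sobolevNorm]
  rw [Finset.sum_range_succ' _ (k + 1), derivNorm_zero, add_comm, Finset.sum_comm]
  gcongr
  exact derivNorm_succ_le _ _

namespace SobolevSpace

variable {k : ℕ}

/-- An element of `H^k`, as a member of the type `SobolevSpace n k`. -/
def mk (f : L2 n) (h : f ∈ sobolev n k) : SobolevSpace n k := ⟨f, h⟩

@[simp]
theorem toL2_mk (f : L2 n) (h : f ∈ sobolev n k) : toL2 (mk f h) = f := rfl

/-- The inclusion of `H^k` in `L²`, as a continuous map. -/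
def toL2CLM : SobolevSpace n k →L[ℝ] L2 n :=
  toL2.mkContinuous 1 fun f => by rw [one_mul]; exact norm_le_sobolevNorm k _

/-- `L²` as `H⁰`. -/
def ofL2 : L2 n →L[ℝ] SobolevSpace n 0 :=
  LinearMap.mkContinuous
    { toFun := fun f => mk f Submodule.mem_top
      map_add' := fun _ _ => rfl
      map_smul' := fun _ _ => rfl } 1 fun f => by
        rw [one_mul]; exact (sobolevNorm_zero f).le

/-- The inclusion of `H^{k+1}` in `H^k`. -/
def incl : SobolevSpace n (k + 1) →L[ℝ] SobolevSpace n k :=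
  LinearMap.mkContinuous
    { toFun := fun f => mk (toL2 f) (sobolev_succ_le k (toL2_mem f))
      map_add' := fun _ _ => rfl
      map_smul' := fun _ _ => rfl } 1 fun f => by
        rw [one_mul]; exact sobolevNorm_le_succ k _

/-- The weak derivative as a continuous map from `H^{k+1}` to `H^k`. -/
def deriv (i : Fin n) : SobolevSpace n (k + 1) →L[ℝ] SobolevSpace n k :=
  LinearMap.mkContinuous
    { toFun := fun f => mk (weakDeriv i (toL2 f)) (weakDeriv_mem_sobolev (toL2_mem f) i)
      map_add' := fun f g => toL2_injective <| by
        simpa using ((hasWeakDeriv_weakDeriv (toL2_mem f) i).add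
          (hasWeakDeriv_weakDeriv (toL2_mem g) i)).weakDeriv_eq
      map_smul' := fun c f => toL2_injective <| by
        simpa using ((hasWeakDeriv_weakDeriv (toL2_mem f) i).smul c).weakDeriv_eq } 1 fun f => by
        rw [one_mul]; exact sobolevNorm_weakDeriv_le k _ i

@[simp]
theorem toL2_deriv (i : Fin n) (f : SobolevSpace n (k + 1)) :
    toL2 (deriv i f) = weakDeriv i (toL2 f) := rfl

/-- The Laplacian as a continuous map from `H^{k+2}` to `H^k`. -/
def lap : SobolevSpace n (k + 2) →L[ℝ] SobolevSpace n k :=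
  ∑ i, (deriv i).comp (deriv i)

@[simp]
theorem toL2_lap (f : SobolevSpace n (k + 2)) : toL2 (lap f) = laplacian (toL2 f) := by
  simp [lap, laplacian]

end SobolevSpace

theorem laplacian_mem_sobolev {k : ℕ} {f : L2 n} (hf : f ∈ sobolev n (k + 2)) :
    laplacian f ∈ sobolev n k :=
  Submodule.sum_mem _ fun _ _ => weakDeriv_mem_sobolev (weakDeriv_mem_sobolev hf _) _

theorem weakDeriv_sub {k : ℕ} {f g : L2 n} (hf : f ∈ sobolev n (k + 1))
    (hg : g ∈ sobolev n (k + 1)) (i : Fin n) :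
    weakDeriv i (f - g) = weakDeriv i f - weakDeriv i g :=
  congrArg SobolevSpace.toL2
    (map_sub (SobolevSpace.deriv i) (SobolevSpace.mk f hf) (SobolevSpace.mk g hg))

theorem laplacian_sub {f g : L2 n} (hf : f ∈ sobolev n 2) (hg : g ∈ sobolev n 2) :
    laplacian (f - g) = laplacian f - laplacian g := by
  have h := congrArg SobolevSpace.toL2
    (map_sub SobolevSpace.lap (SobolevSpace.mk (k := 0 + 2) f hf) (SobolevSpace.mk g hg))
  rwa [SobolevSpace.toL2_lap, map_sub, map_sub, SobolevSpace.toL2_lap,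
    SobolevSpace.toL2_lap] at h

theorem derivNorm_sub_le {k ℓ : ℕ} (hℓ : ℓ ≤ k) {f g : L2 n} (hf : f ∈ sobolev n k)
    (hg : g ∈ sobolev n k) : |derivNorm ℓ f - derivNorm ℓ g| ≤ derivNorm ℓ (f - g) := by
  have hs := sub_mem hf hg
  have h1 := derivNorm_add hℓ hs hg
  have h2 := derivNorm_add hℓ (Submodule.smul_mem _ (-1 : ℝ) hs) hf
  rw [derivNorm_smul hℓ _ hs] at h2
  rw [sub_add_cancel] at h1
  have : (-1 : ℝ) • (f - g) + f = g := by module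
  rw [this] at h2
  norm_num at h2
  rw [abs_le]; constructor <;> linarith

theorem continuous_derivNorm {k ℓ : ℕ} (hℓ : ℓ ≤ k) :
    Continuous fun f : SobolevSpace n k => derivNorm ℓ (SobolevSpace.toL2 f) := by
  refine LipschitzWith.continuous (K := 1) (LipschitzWith.of_dist_le_mul fun f g => ?_)
  rw [NNReal.coe_one, one_mul, Real.dist_eq, dist_eq_norm, SobolevSpace.norm_def, map_sub]
  exact (derivNorm_sub_le hℓ (SobolevSpace.toL2_mem f) (SobolevSpace.toL2_mem g)).trans
    (derivNorm_le_sobolevNorm hℓ _)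

theorem integral_mul_eq_inner (f : L2 n) {φ : Space n → ℝ} (hφ : MemLp φ 2 volume) :
    ∫ x, f x * φ x = inner ℝ (hφ.toLp φ) f := by
  rw [MeasureTheory.L2.inner_def]
  apply integral_congr_ae
  filter_upwards [hφ.coeFn_toLp] with x hx
  rw [hx]; simp 

/-- For a fixed test function both sides of the defining identity are L² inner products, hence
continuous: the weak derivative is a closed operator. -/
theorem HasWeakDeriv.of_tendsto {i : Fin n} {f g : ℕ → L2 n} {f' g' : L2 n}
    (h : ∀ j, HasWeakDeriv i (f j) (g j)) (hf : Tendsto f atTop (𝓝 f'))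
    (hg : Tendsto g atTop (𝓝 g')) : HasWeakDeriv i f' g' := by
  intro φ hφ hc
  have h1 := (continuous_partial hφ (EuclideanSpace.single i 1)).memLp_of_hasCompactSupport
    (μ := volume) (p := 2) (hasCompactSupport_partial hc _)
  have h2 := hφ.continuous.memLp_of_hasCompactSupport (μ := volume) (p := 2) hc
  rw [integral_mul_eq_inner _ h1, integral_mul_eq_inner _ h2]
  have h3 : Tendsto (fun j => inner ℝ (h1.toLp _) (f j)) atTop (𝓝 (inner ℝ (h1.toLp _) f')) :=
    tendsto_const_nhds.inner hf
  have h4 : Tendsto (fun j => inner ℝ (h2.toLp _) (g j)) atTop (𝓝 (inner ℝ (h2.toLp _) g')) :=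
    tendsto_const_nhds.inner hg
  refine tendsto_nhds_unique h3 (h4.neg.congr fun j => ?_)
  rw [← integral_mul_eq_inner _ h1, ← integral_mul_eq_inner _ h2, h j φ hφ hc]

namespace SobolevSpace

theorem tendsto_succ {k : ℕ} {f : ℕ → SobolevSpace n (k + 1)} {g : SobolevSpace n (k + 1)}
    (h0 : Tendsto (fun j => toL2 (f j)) atTop (𝓝 (toL2 g)))
    (h : ∀ i, Tendsto (fun j => deriv i (f j)) atTop (𝓝 (deriv i g))) :
    Tendsto f atTop (𝓝 g) := by
  rw [tendsto_iff_norm_sub_tendsto_zero] at h0 ⊢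
  have h1 := h0.add (tendsto_finsetSum Finset.univ fun i _ =>
    tendsto_iff_norm_sub_tendsto_zero.1 (h i))
  rw [Finset.sum_const_zero, add_zero] at h1
  refine squeeze_zero (fun _ => norm_nonneg _) (fun j => ?_) h1
  simpa only [← map_sub] using! sobolevNorm_succ_le k (toL2 (f j - g))

/-- Induction on k: a Cauchy sequence converges in L², its derivatives converge in the previous
space, and closedness of the weak derivative identifies their limits. -/
instance completeSpace (k : ℕ) : CompleteSpace (SobolevSpace n k) := by
  induction k with
  | zero =>
    refine Metric.complete_of_cauchySeq_tendsto fun f hf => ?_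
    obtain ⟨g, hg⟩ := cauchySeq_tendsto_of_complete
      ((toL2CLM (n := n) (k := 0)).uniformContinuous.comp_cauchySeq hf)
    exact ⟨ofL2 g, ((ofL2.continuous.tendsto g).comp hg :)⟩
  | succ k ih =>
    refine Metric.complete_of_cauchySeq_tendsto fun f hf => ?_
    obtain ⟨g, hg⟩ := cauchySeq_tendsto_of_complete
      ((toL2CLM (n := n) (k := k + 1)).uniformContinuous.comp_cauchySeq hf)
    choose g' hg' using fun i => cauchySeq_tendsto_of_complete
      ((deriv (n := n) (k := k) i).uniformContinuous.comp_cauchySeq hf)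
    have hw : ∀ i, HasWeakDeriv i g (toL2 (g' i)) := fun i =>
      HasWeakDeriv.of_tendsto (fun j => hasWeakDeriv_weakDeriv (toL2_mem (f j)) i) hg
        ((toL2CLM.continuous.tendsto _).comp (hg' i))
    have hmem : g ∈ sobolev n (k + 1) := fun i => ⟨_, toL2_mem (g' i), hw i⟩
    refine ⟨mk g hmem, tendsto_succ hg fun i => ?_⟩
    have : deriv i (mk g hmem) = g' i := toL2_injective (by simpa using (hw i).weakDeriv_eq)
    rw [this]
    exact hg' i

end SobolevSpace
-- Weak derivatives as Fourier multipliers.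
open scoped FourierTransform SchwartzMap LineDeriv ComplexConjugate

/-- The complex Lebesgue space `L²(ℝⁿ; ℂ)`. -/
abbrev CL2 (n : ℕ) : Type := Lp ℂ 2 (volume : Measure (Space n))

/-- The inclusion of the real in the complex `L²` space. -/
def toComplex : L2 n →L[ℝ] CL2 n := Complex.ofRealCLM.compLpL 2 volume

/-- The real part of a complex `L²` function. -/
def rePart : CL2 n →L[ℝ] L2 n := Complex.reCLM.compLpL 2 volume

theorem coeFn_toComplex (f : L2 n) : ∀ᵐ x, toComplex f x = (f x : ℂ) :=
  Complex.ofRealCLM.coeFn_compLpL f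

theorem coeFn_rePart (z : CL2 n) : ∀ᵐ x, rePart z x = (z x).re :=
  Complex.reCLM.coeFn_compLpL z

theorem rePart_toComplex (f : L2 n) : rePart (toComplex f) = f := by
  apply Lp.ext
  filter_upwards [coeFn_rePart (toComplex f), coeFn_toComplex f] with x h1 h2
  rw [h1, h2, Complex.ofReal_re]

/-- The Fourier symbol `2πi ξᵢ` of `∂ᵢ`. -/
def symb (i : Fin n) (ξ : Space n) : ℂ := 2 * Real.pi * Complex.I * (ξ i : ℂ)

theorem conj_symb (i : Fin n) (ξ : Space n) : conj (symb i ξ) = -symb i ξ := by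
  simp [symb, Complex.conj_ofNat]

theorem continuous_symb (i : Fin n) : Continuous (symb i : Space n → ℂ) := by
  unfold symb; fun_prop

/-- `y' = 2πi ξᵢ y` almost everywhere. -/
def IsSymbMul (i : Fin n) (y y' : CL2 n) : Prop := ∀ᵐ ξ, y' ξ = symb i ξ * y ξ

theorem fourier_partial_apply (i : Fin n) (Φ : 𝓢(Space n, ℂ)) (ξ : Space n) :
    𝓕 (∂_{(EuclideanSpace.single i 1 : Space n)} Φ) ξ = symb i ξ * 𝓕 Φ ξ := by
  have h : (inner ℝ · (EuclideanSpace.single i 1 : Space n)).HasTemperateGrowth :=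
    ((innerSL ℝ).flip _).hasTemperateGrowth
  rw [SchwartzMap.fourier_lineDerivOp_eq]
  rw [smul_apply, SchwartzMap.smulLeftCLM_apply_apply h,
    EuclideanSpace.inner_single_right]
  simp only [symb, smul_eq_mul, Complex.real_smul, one_mul, conj_trivial]
  ring

/-- Plancherel turns the derivative into multiplication by its symbol; the symbol is purely
imaginary, so moving it across the inner product produces the minus sign. -/
theorem inner_partial_fourierInv {i : Fin n} {y y' : CL2 n} (h : IsSymbMul i y y')
    (Φ : 𝓢(Space n, ℂ)) :
    inner ℂ ((∂_{(EuclideanSpace.single i 1 : Space n)} Φ).toLp 2 volume) (𝓕⁻ y) =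
      -inner ℂ (Φ.toLp 2 volume) (𝓕⁻ y') := by
  rw [← Lp.inner_fourier_eq, ← Lp.inner_fourier_eq (Φ.toLp 2 volume), FourierTransform.fourier_fourierInv_eq,
    FourierTransform.fourier_fourierInv_eq, SchwartzMap.toLp_fourier_eq,
    SchwartzMap.toLp_fourier_eq, MeasureTheory.L2.inner_def, MeasureTheory.L2.inner_def,
    ← integral_neg]
  apply integral_congr_ae
  filter_upwards [h, (𝓕 Φ).coeFn_toLp 2,
    (𝓕 (∂_{(EuclideanSpace.single i 1 : Space n)} Φ)).coeFn_toLp 2] with ξ h1 h2 h3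
  rw [h1, h2, h3, fourier_partial_apply]
  simp only [RCLike.inner_apply, map_mul, conj_symb]
  ring

theorem integral_rePart_mul (z : CL2 n) {φ : Space n → ℝ} (Φ : 𝓢(Space n, ℂ))
    (h : ∀ x, Φ x = φ x) : ∫ x, rePart z x * φ x = (inner ℂ (Φ.toLp 2 volume) z : ℂ).re := by
  rw [MeasureTheory.L2.inner_def, ← RCLike.re_eq_complex_re, ← integral_re (L2.integrable_inner _ _)]
  apply integral_congr_ae
  filter_upwards [coeFn_rePart z, Φ.coeFn_toLp 2] with x h1 h2
  rw [h1, h2, h]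
  simp

/-- Test functions are real, so one may take the real part of the complex identity. Hence y needs no
Hermitian symmetry, and band-limited solutions never have to be shown to be real. -/
theorem HasWeakDeriv.of_isSymbMul {i : Fin n} {y y' : CL2 n} (h : IsSymbMul i y y') :
    HasWeakDeriv i (rePart (𝓕⁻ y)) (rePart (𝓕⁻ y')) := by
  intro φ hφ hc
  have hc' : HasCompactSupport (Complex.ofRealCLM ∘ φ) := hc.comp_left rfl
  have hφ' : ContDiff ℝ ∞ (Complex.ofRealCLM ∘ φ) := Complex.ofRealCLM.contDiff.comp hφ
  set Φ : 𝓢(Space n, ℂ) := hc'.toSchwartzMap hφ'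
  rw [integral_rePart_mul (φ := φ) _ Φ fun x => rfl,
    integral_rePart_mul _ (∂_{(EuclideanSpace.single i 1 : Space n)} Φ), inner_partial_fourierInv h,
    Complex.neg_re]
  intro x
  rw [SchwartzMap.lineDerivOp_apply_eq_fderiv]
  change fderiv ℝ (Complex.ofRealCLM ∘ φ) x _ = _
  rw [(Complex.ofRealCLM.hasFDerivAt.comp x (hφ.differentiable (by simp) x).hasFDerivAt).fderiv]
  rfl

/-- Smooth cutoff functions that exhaust the space. -/
theorem exists_cutoff (e : Space n) : ∃ (χ : ℕ → Space n → ℝ) (C : ℝ), 0 ≤ C ∧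
    (∀ j, ContDiff ℝ ∞ (χ j)) ∧ (∀ j, HasCompactSupport (χ j)) ∧
    (∀ x, ∀ᶠ j in atTop, χ j x = 1) ∧ (∀ j x, |χ j x| ≤ 1) ∧
    ∀ (j : ℕ) x, |fderiv ℝ (χ j) x e| ≤ (j + 1 : ℝ)⁻¹ * C := by
  obtain ⟨b, hb, hbc, hb1, hbb⟩ : ∃ b : Space n → ℝ, ContDiff ℝ ∞ b ∧ HasCompactSupport b ∧
      (∀ x, ‖x‖ ≤ 1 → b x = 1) ∧ ∀ x, |b x| ≤ 1 := by
    let b : ContDiffBump (0 : Space n) := ⟨1, 2, one_pos, one_lt_two⟩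
    exact ⟨b, b.contDiff, b.hasCompactSupport, fun x hx =>
      b.one_of_mem_closedBall (mem_closedBall_zero_iff.2 hx), fun x => by
        rw [abs_of_nonneg b.nonneg]; exact b.le_one⟩
  obtain ⟨M, hM⟩ : ∃ M, ∀ x, ‖fderiv ℝ b x‖ ≤ M :=
    (hbc.fderiv ℝ).exists_bound_of_continuous (hb.continuous_fderiv (by simp))
  have hM0 : 0 ≤ M := (norm_nonneg _).trans (hM 0)
  -- Dilations of a single bump: each derivative of the cutoff gains the factor 1/(j+1).
  refine ⟨fun j x => b ((j + 1 : ℝ)⁻¹ • x), M * ‖e‖, by positivity,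
    fun j => hb.comp (contDiff_const_smul _), fun j => ?_, fun x => ?_, fun j x => hbb _,
    fun j x => ?_⟩
  · have hj : (j + 1 : ℝ)⁻¹ ≠ 0 := by positivity
    have h := hbc.comp_homeomorph (Homeomorph.smulOfNeZero (α := Space n) _ hj)
    exact h
  · obtain ⟨N, hN⟩ := exists_nat_gt ‖x‖
    filter_upwards [eventually_ge_atTop N] with j hj
    apply hb1
    have : (N : ℝ) ≤ j := by exact_mod_cast hj
    rw [norm_smul, norm_inv, Real.norm_of_nonneg (by positivity),
      inv_mul_le_iff₀ (by positivity)]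
    linarith
  · have h : HasFDerivAt (fun x => b ((j + 1 : ℝ)⁻¹ • x))
        ((fderiv ℝ b ((j + 1 : ℝ)⁻¹ • x)).comp
          ((j + 1 : ℝ)⁻¹ • ContinuousLinearMap.id ℝ (Space n))) x :=
      (hb.differentiable (by simp) _).hasFDerivAt.comp x
        ((hasFDerivAt_id x).const_smul (j + 1 : ℝ)⁻¹)
    rw [h.fderiv]
    simp only [ContinuousLinearMap.comp_apply, smul_apply,
      ContinuousLinearMap.id_apply, map_smul, smul_eq_mul]
    rw [abs_mul, abs_of_nonneg (by positivity)]
    gcongr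
    exact ContinuousLinearMap.le_of_opNorm_le _ (hM _) e

/-- A weak derivative may be tested against smooth functions that are merely in `H¹`. -/
theorem HasWeakDeriv.integral_eq {i : Fin n} {f g : L2 n} (h : HasWeakDeriv i f g)
    {ψ : Space n → ℝ} (hψ : ContDiff ℝ ∞ ψ) (h0 : MemLp ψ 2 volume)
    (h1 : MemLp (fun x => fderiv ℝ ψ x (EuclideanSpace.single i 1)) 2 volume) :
    ∫ x, f x * fderiv ℝ ψ x (EuclideanSpace.single i 1) = -∫ x, g x * ψ x := by
  obtain ⟨χ, C, hC, hχ, hχc, hχ1, hχb, hdχb⟩ := exists_cutoff (EuclideanSpace.single i 1 : Space n)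
  set e : Space n := EuclideanSpace.single i 1
  have i1 : Integrable (fun x => f x * fderiv ℝ ψ x e) := (Lp.memLp f).integrable_mul h1
  have i2 : Integrable (fun x => f x * ψ x) := (Lp.memLp f).integrable_mul h0
  have i3 : Integrable (fun x => g x * ψ x) := (Lp.memLp g).integrable_mul h0
  -- The admissible test function χⱼψ; the term with the derivative of χⱼ vanishes in the limit.
  have key : ∀ j, ∫ x, (χ j x * (f x * fderiv ℝ ψ x e) + fderiv ℝ (χ j) x e * (f x * ψ x)) =
      -∫ x, χ j x * (g x * ψ x) := by
    intro j
    have := h (fun x => χ j x * ψ x) ((hχ j).mul hψ) ((hχc j).mul_right)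
    refine Eq.trans ?_ (this.trans ?_)
    · apply integral_congr_ae
      filter_upwards with x
      have : HasFDerivAt (fun x => χ j x * ψ x) (χ j x • fderiv ℝ ψ x + ψ x • fderiv ℝ (χ j) x) x :=
        ((hχ j).differentiable (by simp) x).hasFDerivAt.mul
          (hψ.differentiable (by simp) x).hasFDerivAt
      rw [this.fderiv]
      simp only [add_apply, smul_apply, smul_eq_mul]
      ring
    · congr 1
      apply integral_congr_ae
      filter_upwards with x
      ring
  have l1 : Tendsto (fun j => -∫ x, χ j x * (g x * ψ x)) atTop (𝓝 (-∫ x, g x * ψ x)) := by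
    refine (tendsto_integral_of_dominated_convergence (fun x => ‖g x * ψ x‖)
      (fun j => (hχ j).continuous.aestronglyMeasurable.mul i3.1) i3.norm (fun j => ?_) ?_).neg
    · filter_upwards with x
      rw [Pi.mul_apply, norm_mul]
      exact mul_le_of_le_one_left (norm_nonneg _) (hχb j x)
    · filter_upwards with x
      exact tendsto_const_nhds.congr' ((hχ1 x).mono fun j hj => by simp [hj])
  have l2 : Tendsto (fun j => ∫ x, (χ j x * (f x * fderiv ℝ ψ x e) +
      fderiv ℝ (χ j) x e * (f x * ψ x))) atTop (𝓝 (∫ x, f x * fderiv ℝ ψ x e)) := by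
    refine tendsto_integral_of_dominated_convergence
      (fun x => ‖f x * fderiv ℝ ψ x e‖ + C * ‖f x * ψ x‖)
      (fun j => ((hχ j).continuous.aestronglyMeasurable.mul i1.1).add
        ((continuous_partial (hχ j) e).aestronglyMeasurable.mul i2.1))
      (i1.norm.add (i2.norm.const_mul _)) (fun j => ?_) ?_
    · filter_upwards with x
      refine (norm_add_le _ _).trans ?_
      rw [norm_mul, norm_mul (fderiv ℝ (χ j) x e)]
      gcongr
      · exact mul_le_of_le_one_left (norm_nonneg _) (hχb j x)
      · refine (hdχb j x).trans (mul_le_of_le_one_left (hC) (inv_le_one_of_one_le₀ (by simp)))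
    · filter_upwards with x
      have t1 : Tendsto (fun j => χ j x * (f x * fderiv ℝ ψ x e)) atTop
          (𝓝 (f x * fderiv ℝ ψ x e)) :=
        tendsto_const_nhds.congr' ((hχ1 x).mono fun j hj => by simp [hj])
      have t2 : Tendsto (fun j => fderiv ℝ (χ j) x e) atTop (𝓝 0) := by
        refine squeeze_zero_norm (fun j => hdχb j x) ?_
        have := (tendsto_one_div_add_atTop_nhds_zero_nat (𝕜 := ℝ)).mul_const (C)
        simpa [one_div] using this
      simpa using t1.add (t2.mul_const (f x * ψ x))
  exact tendsto_nhds_unique l2 (l1.congr fun j => (key j).symm)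

theorem inner_toComplex (f : L2 n) (Φ : 𝓢(Space n, ℂ)) :
    inner ℂ (Φ.toLp 2 volume) (toComplex f) =
      ((∫ x, f x * (Φ x).re : ℝ) : ℂ) - (∫ x, f x * (Φ x).im : ℝ) * Complex.I := by
  have hre : MemLp (fun x => (Φ x).re) 2 volume := (Φ.memLp 2).re
  have him : MemLp (fun x => (Φ x).im) 2 volume := (Φ.memLp 2).im
  have i1 : Integrable (fun x => f x * (Φ x).re) := (Lp.memLp f).integrable_mul hre
  have i2 : Integrable (fun x => f x * (Φ x).im) := (Lp.memLp f).integrable_mul him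
  rw [← integral_complex_ofReal, ← integral_complex_ofReal, ← integral_mul_const, ← integral_sub i1.ofReal
    (i2.ofReal.mul_const _), MeasureTheory.L2.inner_def]
  apply integral_congr_ae
  filter_upwards [coeFn_toComplex f, Φ.coeFn_toLp 2] with x h1 h2
  rw [h1, h2]
  apply Complex.ext <;> simp

theorem HasWeakDeriv.inner_partial {i : Fin n} {f g : L2 n} (h : HasWeakDeriv i f g)
    (Φ : 𝓢(Space n, ℂ)) :
    inner ℂ ((∂_{(EuclideanSpace.single i 1 : Space n)} Φ).toLp 2 volume) (toComplex f) =
      -inner ℂ (Φ.toLp 2 volume) (toComplex g) := by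
  set e : Space n := EuclideanSpace.single i 1
  have hd : ∀ x, HasFDerivAt Φ (fderiv ℝ Φ x) x := fun x => Φ.differentiableAt.hasFDerivAt
  have hre : ∀ x, fderiv ℝ (fun x => (Φ x).re) x e = ((∂_{e} Φ) x).re := fun x => by
    rw [SchwartzMap.lineDerivOp_apply_eq_fderiv]
    exact congrArg (· e) (Complex.reCLM.hasFDerivAt.comp x (hd x)).fderiv
  have him : ∀ x, fderiv ℝ (fun x => (Φ x).im) x e = ((∂_{e} Φ) x).im := fun x => by
    rw [SchwartzMap.lineDerivOp_apply_eq_fderiv]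
    exact congrArg (· e) (Complex.imCLM.hasFDerivAt.comp x (hd x)).fderiv
  have hs : ContDiff ℝ ∞ Φ := Φ.smooth ⊤
  have h1 := h.integral_eq (ψ := fun x => (Φ x).re) (Complex.reCLM.contDiff.comp hs)
    (Φ.memLp 2).re (((∂_{e} Φ).memLp 2).re.ae_eq (ae_of_all _ fun x => (hre x).symm))
  have h2 := h.integral_eq (ψ := fun x => (Φ x).im) (Complex.imCLM.contDiff.comp hs)
    (Φ.memLp 2).im (((∂_{e} Φ).memLp 2).im.ae_eq (ae_of_all _ fun x => (him x).symm))
  rw [inner_toComplex, inner_toComplex]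
  change ∫ x, f x * fderiv ℝ (fun x => (Φ x).re) x e = _ at h1
  change ∫ x, f x * fderiv ℝ (fun x => (Φ x).im) x e = _ at h2
  simp only [hre, him] at h1 h2
  rw [h1, h2]
  push_cast
  ring

theorem locallyIntegrable_symb_mul (i : Fin n) (y : CL2 n) :
    LocallyIntegrable (fun ξ => symb i ξ * y ξ) volume := by
  simpa [smul_eq_mul] using ((Lp.memLp y).locallyIntegrable (by norm_num)).continuous_smul
    (continuous_symb i)

/-- The identity is tested on the frequency side against compactly supported Ψ. The corresponding
test function in space is 𝓕⁻Ψ, which is only Schwartz; this is why weak derivatives had to be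
extended beyond C_c^∞ tests. -/
theorem HasWeakDeriv.isSymbMul {i : Fin n} {f g : L2 n} (h : HasWeakDeriv i f g) :
    IsSymbMul i (𝓕 (toComplex f)) (𝓕 (toComplex g)) := by
  apply ae_eq_of_integral_contDiff_smul_eq
  · exact (Lp.memLp _).locallyIntegrable (by norm_num)
  · exact locallyIntegrable_symb_mul i _
  · intro φ hφ hc
    have hc' : HasCompactSupport (Complex.ofRealCLM ∘ φ) := hc.comp_left rfl
    have hφ' : ContDiff ℝ ∞ (Complex.ofRealCLM ∘ φ) := Complex.ofRealCLM.contDiff.comp hφ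
    set Ψ : 𝓢(Space n, ℂ) := hc'.toSchwartzMap hφ' with hΨ
    have hΨx : ∀ x, Ψ x = φ x := fun x => rfl
    have hi := h.inner_partial (𝓕⁻ Ψ)
    rw [← Lp.inner_fourier_eq, ← Lp.inner_fourier_eq ((𝓕⁻ Ψ : 𝓢(Space n, ℂ)).toLp 2 volume), SchwartzMap.toLp_fourier_eq,
      SchwartzMap.toLp_fourier_eq, MeasureTheory.L2.inner_def, MeasureTheory.L2.inner_def,
      ← integral_neg] at hi
    have e1 : ∫ ξ, φ ξ • (symb i ξ * (𝓕 (toComplex f) : CL2 n) ξ) = -∫ ξ, inner ℂ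
        ((𝓕 (∂_{(EuclideanSpace.single i 1 : Space n)} (𝓕⁻ Ψ))).toLp 2 volume ξ)
        ((𝓕 (toComplex f) : CL2 n) ξ) := by
      rw [← integral_neg]
      apply integral_congr_ae
      filter_upwards [(𝓕 (∂_{(EuclideanSpace.single i 1 : Space n)} (𝓕⁻ Ψ))).coeFn_toLp 2]
        with ξ h1
      rw [h1, fourier_partial_apply, FourierTransform.fourier_fourierInv_eq, hΨx]
      simp only [RCLike.inner_apply, map_mul, conj_symb, Complex.conj_ofReal, Complex.real_smul]
      ring
    rw [e1, hi, integral_neg, neg_neg]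
    apply integral_congr_ae
    filter_upwards [(𝓕 (𝓕⁻ Ψ)).coeFn_toLp 2] with ξ h1
    rw [h1, FourierTransform.fourier_fourierInv_eq, hΨx]
    simp [mul_comm]

theorem rePart_fourierInv_fourier (f : L2 n) : rePart (𝓕⁻ (𝓕 (toComplex f))) = f := by
  rw [FourierTransform.fourierInv_fourier_eq, rePart_toComplex]

/-- Weak derivatives commute. -/
theorem HasWeakDeriv.comm {i j : Fin n} {f g h k : L2 n} (hg : HasWeakDeriv i f g)
    (hh : HasWeakDeriv j f h) (hk : HasWeakDeriv j g k) : HasWeakDeriv i h k := by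
  rw [← rePart_fourierInv_fourier h, ← rePart_fourierInv_fourier k]
  apply HasWeakDeriv.of_isSymbMul
  filter_upwards [hg.isSymbMul, hh.isSymbMul, hk.isSymbMul] with ξ h1 h2 h3
  rw [h3, h1, h2]
  ring

theorem inner_toComplex_toComplex (f g : L2 n) :
    inner ℂ (toComplex f) (toComplex g) = ((inner ℝ f g : ℝ) : ℂ) := by
  rw [MeasureTheory.L2.inner_def, MeasureTheory.L2.inner_def, ← integral_complex_ofReal]
  apply integral_congr_ae
  filter_upwards [coeFn_toComplex f, coeFn_toComplex g] with x h1 h2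
  rw [h1, h2]
  simp

/-- Integration by parts in `H¹`. -/
theorem HasWeakDeriv.inner_eq {i : Fin n} {f f' g g' : L2 n} (hf : HasWeakDeriv i f f')
    (hg : HasWeakDeriv i g g') : inner ℝ f' g = -inner ℝ f g' := by
  apply Complex.ofReal_injective
  rw [Complex.ofReal_neg, ← inner_toComplex_toComplex, ← inner_toComplex_toComplex,
    ← Lp.inner_fourier_eq, ← Lp.inner_fourier_eq (toComplex f), MeasureTheory.L2.inner_def,
    MeasureTheory.L2.inner_def, ← integral_neg]
  apply integral_congr_ae
  filter_upwards [hf.isSymbMul, hg.isSymbMul] with ξ h1 h2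
  rw [h1, h2]
  simp only [RCLike.inner_apply, map_mul, conj_symb]
  ring
-- The modified energy in an abstract Hilbert space.
section Energy

variable {H ι : Type*} [NormedAddCommGroup H] [InnerProductSpace ℝ H] [Fintype ι]

/-- The modified energy of a damped wave equation in a Hilbert space decreases. -/
theorem modifiedEnergy_antitoneOn {μ α γ : ℝ} (hα₀ : 0 ≤ α) (hαμ : α ≤ μ) (hα₂ : α ≤ 2)
    (hγ : γ = α * (1 + μ - α) / 2) {u v L : ℝ → H} {p q : ι → ℝ → H}
    (hu : ∀ t > 0, HasDerivAt u (v t) t)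
    (hv : ∀ t > 0, HasDerivAt v (L t - (μ / (1 + t)) • v t) t)
    (hp : ∀ i, ∀ t > 0, HasDerivAt (p i) (q i t) t)
    (cu : ContinuousOn u (Ici 0)) (cv : ContinuousOn v (Ici 0))
    (cp : ∀ i, ContinuousOn (p i) (Ici 0))
    (hpq : ∀ t > 0, ∑ i, inner ℝ (p i t) (q i t) = -inner ℝ (L t) (v t))
    (hpp : ∀ t > 0, ∑ i, ‖p i t‖ ^ 2 = -inner ℝ (L t) (u t)) :
    AntitoneOn (fun t => (1 + t) ^ α * (‖v t‖ ^ 2 + ∑ i, ‖p i t‖ ^ 2 +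
      α / (1 + t) * inner ℝ (u t) (v t) + γ / (1 + t) ^ 2 * ‖u t‖ ^ 2)) (Ici 0) := by
  have hτ : ∀ t ∈ Ici (0 : ℝ), 1 + t ≠ 0 := fun t (ht : 0 ≤ t) => by positivity
  have cτ : ContinuousOn (fun t : ℝ => 1 + t) (Ici 0) := by fun_prop
  have key : ∀ t > 0, HasDerivAt (fun t => (1 + t) ^ α * (‖v t‖ ^ 2 + ∑ i, ‖p i t‖ ^ 2 +
      α / (1 + t) * inner ℝ (u t) (v t) + γ / (1 + t) ^ 2 * ‖u t‖ ^ 2))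
      ((1 + t) ^ α / (1 + t) * ((2 * α - 2 * μ) * ‖v t‖ ^ 2 +
        γ * (α - 2) / (1 + t) ^ 2 * ‖u t‖ ^ 2)) t := by
    intro t ht
    have h0 : 0 < 1 + t := by linarith
    have dτ : HasDerivAt (fun t : ℝ => 1 + t) 1 t := (hasDerivAt_id t).const_add 1
    have d1 := dτ.rpow_const (p := α) (Or.inl h0.ne')
    have d2 := (hv t ht).norm_sq
    have d3 := HasDerivAt.fun_sum (u := Finset.univ) fun i _ => (hp i t ht).norm_sq
    have d4 := ((hasDerivAt_const t α).div dτ h0.ne').mul ((hu t ht).inner ℝ (hv t ht))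
    have d5 := ((hasDerivAt_const t γ).div (dτ.pow 2) (pow_ne_zero 2 h0.ne')).mul (hu t ht).norm_sq
    have d := d1.mul (((d2.add d3).add d4).add d5)
    -- `hpq` and `hpp` play the role of Green's identities for ⟨∇u,∇v⟩ and ‖∇u‖². After inserting
    -- them the gradient terms cancel, and the value of γ removes the ⟨u,v⟩ terms.
    refine d.congr_deriv ?_
    rw [← Finset.mul_sum, hpq t ht]
    have e2 := hpp t ht
    simp only [Pi.add_apply, Pi.mul_apply, Pi.div_apply, Pi.pow_apply, inner_sub_right,
      inner_smul_right, real_inner_self_eq_norm_sq, e2,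
      Real.rpow_sub_one h0.ne', real_inner_comm (L t)]
    rw [real_inner_comm (v t) (L t), real_inner_comm (u t) (L t), real_inner_comm (v t) (u t), hγ]
    field_simp
    ring
  refine antitoneOn_of_deriv_nonpos (convex_Ici 0) ?_ ?_ ?_
  · refine (cτ.rpow_const fun t ht => Or.inl (hτ t ht)).mul (((cv.norm.pow 2).add
      (continuousOn_finsetSum _ fun i _ => (cp i).norm.pow 2)).add
      ((continuousOn_const.div cτ hτ).mul (cu.inner cv)) |>.add
      ((continuousOn_const.div (cτ.pow 2) fun t ht => pow_ne_zero _ (hτ t ht)).mul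
        (cu.norm.pow 2)))
  · rw [interior_Ici]
    exact fun t ht => (key t ht).differentiableAt.differentiableWithinAt
  · rw [interior_Ici]
    intro t ht
    rw [(key t ht).deriv]
    have h0 : 0 < 1 + t := add_pos one_pos ht
    have hγ0 : 0 ≤ γ := by
      rw [hγ]; exact div_nonneg (mul_nonneg hα₀ (by linarith)) zero_le_two
    refine mul_nonpos_of_nonneg_of_nonpos (by positivity) (add_nonpos ?_ ?_)
    · exact mul_nonpos_of_nonpos_of_nonneg (by linarith) (sq_nonneg _)
    · refine mul_nonpos_of_nonpos_of_nonneg (div_nonpos_of_nonpos_of_nonneg ?_ (sq_nonneg _))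
        (sq_nonneg _)
      exact mul_nonpos_of_nonneg_of_nonpos hγ0 (by linarith)

/-- The modified energy is equivalent to the energy. -/
theorem modifiedEnergy_equiv {α γ m : ℝ} (hα₀ : 0 ≤ α) (hα₂ : α ≤ 2)
    (hγ : α ^ 2 / 4 < γ) (hm0 : 0 < m) (hm1 : m ≤ 1 / 2) (hm2 : m ≤ (γ - α ^ 2 / 4) / 3)
    {τ b : ℝ} (u v : H) (hτ : 0 < τ) (hb : 0 ≤ b) :
    m * (‖u‖ ^ 2 / τ ^ 2 + ‖v‖ ^ 2 + b) ≤
        ‖v‖ ^ 2 + b + α / τ * inner ℝ u v + γ / τ ^ 2 * ‖u‖ ^ 2 ∧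
      ‖v‖ ^ 2 + b + α / τ * inner ℝ u v + γ / τ ^ 2 * ‖u‖ ^ 2 ≤
        (1 + α + γ) * (‖u‖ ^ 2 / τ ^ 2 + ‖v‖ ^ 2 + b) := by
  have hγ0 : 0 < γ := lt_of_le_of_lt (by positivity) hγ
  set y := ‖u‖ / τ with hy
  have hy0 : 0 ≤ y := by positivity
  set x := ‖v‖
  have hx0 : 0 ≤ x := norm_nonneg _
  have e1 : ‖u‖ ^ 2 / τ ^ 2 = y ^ 2 := (div_pow _ _ _).symm
  have e2 : γ / τ ^ 2 * ‖u‖ ^ 2 = γ * y ^ 2 := by rw [← e1]; ring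
  obtain ⟨c, hc, hc1, hc2⟩ : ∃ c, α / τ * inner ℝ u v = α * c ∧ c ≤ x * y ∧ -(x * y) ≤ c := by
    refine ⟨inner ℝ u v / τ, by ring, ?_, ?_⟩
    · rw [div_le_iff₀ hτ]
      refine (real_inner_le_norm u v).trans_eq ?_
      rw [hy]; field_simp; ring
    · rw [le_div_iff₀ hτ]
      refine le_of_eq_of_le ?_ (neg_le_of_abs_le (abs_real_inner_le_norm u v))
      rw [hy]; field_simp; ring
  rw [e1, e2, hc]
  constructor
  · have h1 : -(α * (x * y)) ≤ α * c := by nlinarith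
    -- The form is at least (x - αy/2)² + (γ - α²/4)y². Here x² is bounded by the completed square
    -- and y², which asks for m ≤ 1/2; since α ≤ 2, the total weight of y² is m(α²/2 + 1) ≤ 3m,
    -- whence the divisor 3 in `hm2`.
    have h2 : m * x ^ 2 ≤ m * (2 * (x - α * y / 2) ^ 2 + α ^ 2 * y ^ 2 / 2) := by
      gcongr
      nlinarith [sq_nonneg (x - α * y)]
    have h3 : m * (2 * (x - α * y / 2) ^ 2) ≤ 1 / 2 * (2 * (x - α * y / 2) ^ 2) := by gcongr
    have h4 : m * (α ^ 2 / 2 + 1) ≤ γ - α ^ 2 / 4 := by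
      have : m * (α ^ 2 / 2 + 1) ≤ m * 3 := by gcongr; nlinarith
      linarith
    have h5 := mul_le_mul_of_nonneg_right h4 (sq_nonneg y)
    have h6 : m * b ≤ b := mul_le_of_le_one_left hb (by linarith)
    nlinarith
  · have h1 : α * c ≤ α * (x * y) := by nlinarith
    have h2 : α * (x * y) ≤ α * (x ^ 2 + y ^ 2) := by
      gcongr; nlinarith [sq_nonneg (x - y)]
    have h3 : 0 ≤ α * b := by positivity
    have h4 : 0 ≤ γ * b := by positivity
    have h5 : 0 ≤ γ * x ^ 2 := by positivity
    nlinarith [sq_nonneg y]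

end Energy

/-- The conditions under which the modified energy decreases and is positive definite. The last one
amounts to 3α < 2(1+μ): for α = μ it reads μ < 2, for α = 2 it reads μ > 2, and at μ = 2 it forces α
< 2. -/
theorem alpha0_bounds {μ η : ℝ} (hμ : 0 < μ) (hη₀ : 0 < η) (hη₂ : η < 2) :
    0 ≤ alpha0 μ η ∧ alpha0 μ η ≤ μ ∧ alpha0 μ η ≤ 2 ∧
      alpha0 μ η ^ 2 / 4 < alpha0 μ η * (1 + μ - alpha0 μ η) / 2 := by
  unfold alpha0
  split_ifs with h1 h2
  · exact ⟨hμ.le, le_rfl, h1.le, by nlinarith⟩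
  · subst h2
    exact ⟨by linarith, by linarith, by linarith, by nlinarith⟩
  · have : 2 < μ := lt_of_le_of_ne (not_lt.1 h1) (Ne.symm h2)
    exact ⟨by norm_num, by linarith, le_rfl, by nlinarith⟩

/-! ### Linear differential equations in Banach spaces. -/

section LinearODE

variable {E : Type*} [NormedAddCommGroup E] [NormedSpace ℝ E]

theorem norm_integral_exp_smul_le {f : ℝ → E} {c a t : ℝ} (ha : 0 < a) (ht : 0 ≤ t)
    (hf : ∀ s, ‖f s‖ ≤ c) : ‖∫ s in (0 : ℝ)..t, Real.exp (a * s) • f s‖ ≤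
      Real.exp (a * t) * (c / a) := by
  have hc : 0 ≤ c := (norm_nonneg _).trans (hf 0)
  have hd : ∀ s : ℝ, HasDerivAt (fun s => Real.exp (a * s) * (c / a)) (Real.exp (a * s) * c) s := by
    intro s
    have := (((hasDerivAt_id s).const_mul a).exp).mul_const (c / a)
    refine this.congr_deriv ?_
    simp only [id]
    field_simp
  have hi : IntervalIntegrable (fun s => Real.exp (a * s) * c) volume 0 t :=
    Continuous.intervalIntegrable (by fun_prop) _ _
  have h1 := intervalIntegral.norm_integral_le_of_norm_le (f := fun s => Real.exp (a * s) • f s)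
    (g := fun s => Real.exp (a * s) * c) ht (ae_of_all _ fun s _ => by
      rw [norm_smul, Real.norm_of_nonneg (Real.exp_pos _).le]
      gcongr
      exact hf s) hi
  rw [intervalIntegral.integral_eq_sub_of_hasDerivAt (fun s _ => hd s) hi] at h1
  refine h1.trans (sub_le_self _ (by positivity))

/-- Global solvability of linear differential equations with bounded continuous coefficients. -/
theorem exists_hasDerivAt_linear [CompleteSpace E] {L : ℝ → E →L[ℝ] E} (hL : Continuous L) {K : ℝ}
    (hK : ∀ t, ‖L t‖ ≤ K) (x₀ : E) :
    ∃ X : ℝ → E, X 0 = x₀ ∧ ∀ t, 0 ≤ t → HasDerivAt X (L t (X t)) t := by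
  have hK0 : 0 ≤ K := (norm_nonneg _).trans (hK 0)
  -- In the norm weighted by e^(-at) the Picard map has Lipschitz constant K/a, which is at most 1/2
  -- for this a; so one contraction argument covers all positive times.
  set a : ℝ := 2 * K + 1 with ha
  have ha0 : 0 < a := by positivity
  have hLb : ∀ (Z : BoundedContinuousFunction ℝ E) s, ‖L s (Z s)‖ ≤ K * ‖Z‖ := fun Z s =>
    ((L s).le_of_opNorm_le (hK s) _).trans (by gcongr; exact Z.norm_coe_le_norm s)
  have hcont : ∀ Z : BoundedContinuousFunction ℝ E,
      Continuous fun s => Real.exp (a * s) • L s (Z s) := fun Z =>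
    Continuous.smul (by fun_prop) (hL.clm_apply Z.continuous)
  have hder : ∀ (Z : BoundedContinuousFunction ℝ E) (t : ℝ),
      HasDerivAt (fun t => x₀ + ∫ s in (0 : ℝ)..t, Real.exp (a * s) • L s (Z s))
        (Real.exp (a * t) • L t (Z t)) t := fun Z t =>
    ((hcont Z).integral_hasStrictDerivAt 0 t).hasDerivAt.const_add x₀
  let G : BoundedContinuousFunction ℝ E → ℝ → E := fun Z t =>
    x₀ + ∫ s in (0 : ℝ)..t, Real.exp (a * s) • L s (Z s)
  have hG : ∀ Z, Continuous (G Z) := fun Z =>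
    continuous_iff_continuousAt.2 fun t => (hder Z t).continuousAt
  -- Z stands for e^(-at) X(t). With `max t 0` the image is constant for negative times, so only
  -- forward growth matters.
  let Φ : BoundedContinuousFunction ℝ E → BoundedContinuousFunction ℝ E := fun Z =>
    BoundedContinuousFunction.ofNormedAddCommGroup
      (fun t => Real.exp (-(a * max t 0)) • G Z (max t 0))
      (Continuous.smul (by fun_prop) ((hG Z).comp (by fun_prop))) (‖x₀‖ + K * ‖Z‖ / a) fun t => by
        have ht : 0 ≤ max t 0 := le_max_right _ _
        have h1 := norm_integral_exp_smul_le ha0 ht (hLb Z)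
        rw [norm_smul, Real.norm_of_nonneg (Real.exp_pos _).le]
        calc Real.exp (-(a * max t 0)) * ‖G Z (max t 0)‖
            ≤ Real.exp (-(a * max t 0)) * (‖x₀‖ + Real.exp (a * max t 0) * (K * ‖Z‖ / a)) := by
              gcongr
              exact (norm_add_le _ _).trans (by gcongr)
          _ = Real.exp (-(a * max t 0)) * ‖x₀‖ + K * ‖Z‖ / a := by
              rw [mul_add, ← mul_assoc, ← Real.exp_add, neg_add_cancel, Real.exp_zero, one_mul]
          _ ≤ ‖x₀‖ + K * ‖Z‖ / a := by
              gcongr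
              refine mul_le_of_le_one_left (norm_nonneg _) (Real.exp_le_one_iff.2 ?_)
              rw [neg_nonpos]; positivity
  have hΦ : ContractingWith (1 / 2) Φ := by
    refine ⟨by rw [← NNReal.coe_lt_coe]; norm_num, LipschitzWith.of_dist_le_mul fun Z Z' => ?_⟩
    rw [BoundedContinuousFunction.dist_le (by positivity)]
    intro t
    have ht : 0 ≤ max t 0 := le_max_right _ _
    have h1 := norm_integral_exp_smul_le (f := fun s => L s ((Z - Z') s)) ha0 ht (hLb (Z - Z'))
    have e : G Z (max t 0) - G Z' (max t 0) =
        ∫ s in (0 : ℝ)..(max t 0), Real.exp (a * s) • L s ((Z - Z') s) := by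
      simp only [G, add_sub_add_left_eq_sub]
      rw [← intervalIntegral.integral_sub ((hcont Z).intervalIntegrable _ _)
        ((hcont Z').intervalIntegrable _ _)]
      simp [smul_sub]
    calc dist (Φ Z t) (Φ Z' t)
        = Real.exp (-(a * max t 0)) * ‖G Z (max t 0) - G Z' (max t 0)‖ := by
          rw [dist_eq_norm]
          change ‖Real.exp (-(a * max t 0)) • G Z (max t 0) -
            Real.exp (-(a * max t 0)) • G Z' (max t 0)‖ = _
          rw [← smul_sub, norm_smul, Real.norm_of_nonneg (Real.exp_pos _).le]
      _ ≤ Real.exp (-(a * max t 0)) * (Real.exp (a * max t 0) * (K * ‖Z - Z'‖ / a)) := by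
          rw [e]; gcongr
      _ = K / a * ‖Z - Z'‖ := by
          rw [← mul_assoc, ← Real.exp_add, neg_add_cancel, Real.exp_zero]; ring
      _ ≤ (1 / 2 : NNReal) * dist Z Z' := by
          rw [dist_eq_norm]
          gcongr
          rw [div_le_iff₀ ha0]
          push_cast
          linarith
  set Z := ContractingWith.fixedPoint Φ hΦ
  have hZ : Φ Z = Z := hΦ.fixedPoint_isFixedPt
  have hZt : ∀ t, 0 ≤ t → Real.exp (a * t) • Z t = G Z t := by
    intro t ht
    have : Z t = Real.exp (-(a * max t 0)) • G Z (max t 0) := by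
      conv_lhs => rw [← hZ]
      rfl
    rw [this, max_eq_left ht, smul_smul, ← Real.exp_add, add_neg_cancel, Real.exp_zero, one_smul]
  refine ⟨G Z, by simp [G], fun t ht => ?_⟩
  rw [← hZt t ht, map_smul]
  exact hder Z t

end LinearODE

/-! ### Frequency truncation and band-limited functions. -/

theorem memLp_bounded_mul {m : Space n → ℂ} (hm : Measurable m) {C : ℝ} (hC : ∀ ξ, ‖m ξ‖ ≤ C)
    (z : CL2 n) : MemLp (fun ξ => m ξ * z ξ) 2 volume :=
  (Lp.memLp z).of_le_mul (hm.aestronglyMeasurable.mul (Lp.memLp z).1) (c := C)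
    (ae_of_all _ fun ξ => by rw [norm_mul]; gcongr; exact hC ξ)

/-- Multiplication by a bounded measurable function on `L²`. -/
def mulOp (m : Space n → ℂ) (hm : Measurable m) (C : ℝ) (hC : ∀ ξ, ‖m ξ‖ ≤ C) :
    CL2 n →L[ℝ] CL2 n :=
  LinearMap.mkContinuous
    { toFun := fun z => (memLp_bounded_mul hm hC z).toLp
      map_add' := fun z z' => by
        rw [← MemLp.toLp_add]
        apply MemLp.toLp_congr
        filter_upwards [Lp.coeFn_add z z'] with ξ h1
        rw [h1, Pi.add_apply, Pi.add_apply, mul_add]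
      map_smul' := fun c z => by
        rw [RingHom.id_apply, ← MemLp.toLp_const_smul]
        apply MemLp.toLp_congr
        filter_upwards [Lp.coeFn_smul c z] with ξ h1
        rw [h1, Pi.smul_apply, Pi.smul_apply, mul_smul_comm] } C fun z => by
      refine Lp.norm_le_mul_norm_of_ae_le_mul ?_
      filter_upwards [(memLp_bounded_mul hm hC z).coeFn_toLp] with ξ h1
      simp only [LinearMap.coe_mk, AddHom.coe_mk]
      rw [h1, norm_mul]
      gcongr
      exact hC ξ

theorem coeFn_mulOp (m : Space n → ℂ) (hm : Measurable m) (C : ℝ) (hC : ∀ ξ, ‖m ξ‖ ≤ C)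
    (z : CL2 n) : ∀ᵐ ξ, mulOp m hm C hC z ξ = m ξ * z ξ :=
  (memLp_bounded_mul hm hC z).coeFn_toLp

/-- The indicator function of the ball of radius `R`. -/
def ballInd (R : ℕ) (ξ : Space n) : ℂ := (Metric.closedBall 0 (R : ℝ)).indicator 1 ξ

theorem measurable_ballInd (R : ℕ) : Measurable (ballInd R : Space n → ℂ) :=
  measurable_one.indicator Metric.isClosed_closedBall.measurableSet

theorem norm_ballInd_le (R : ℕ) (ξ : Space n) : ‖ballInd R ξ‖ ≤ 1 := by
  unfold ballInd
  by_cases h : ξ ∈ Metric.closedBall 0 (R : ℝ) <;> simp [h]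

theorem ballInd_mul_self (R : ℕ) (ξ : Space n) : ballInd R ξ * ballInd R ξ = ballInd R ξ := by
  unfold ballInd
  by_cases h : ξ ∈ Metric.closedBall 0 (R : ℝ) <;> simp [h]

theorem norm_symb_mul_ballInd_le (i : Fin n) (R : ℕ) (ξ : Space n) :
    ‖symb i ξ * ballInd R ξ‖ ≤ 2 * Real.pi * R := by
  unfold ballInd
  by_cases h : ξ ∈ Metric.closedBall 0 (R : ℝ)
  · have h1 : |ξ i| ≤ R := (PiLp.norm_apply_le ξ i).trans (mem_closedBall_zero_iff.1 h)
    simp only [h, indicator_of_mem, Pi.one_apply, mul_one, symb, norm_mul, Complex.norm_I,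
      Complex.norm_real, Real.norm_eq_abs, RCLike.norm_ofNat, abs_of_pos Real.pi_pos]
    gcongr
  · simp only [h, not_false_eq_true, indicator_of_notMem, mul_zero, norm_zero]
    positivity

/-- The truncation to frequencies of size at most `R`. -/
def freqCut (R : ℕ) : CL2 n →L[ℝ] CL2 n :=
  mulOp (ballInd R) (measurable_ballInd R) 1 (norm_ballInd_le R)

/-- The symbol of `∂ᵢ`, restricted to frequencies of size at most `R`. -/
def symbCut (R : ℕ) (i : Fin n) : CL2 n →L[ℝ] CL2 n :=
  mulOp (fun ξ => symb i ξ * ballInd R ξ)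
    ((continuous_symb i).measurable.mul (measurable_ballInd R)) _ (norm_symb_mul_ballInd_le i R)

theorem coeFn_freqCut (R : ℕ) (z : CL2 n) : ∀ᵐ ξ, freqCut R z ξ = ballInd R ξ * z ξ :=
  coeFn_mulOp _ _ _ _ z

theorem coeFn_symbCut (R : ℕ) (i : Fin n) (z : CL2 n) :
    ∀ᵐ ξ, symbCut R i z ξ = symb i ξ * ballInd R ξ * z ξ :=
  coeFn_mulOp _ _ _ _ z

/-- The band-limited function with the given frequencies. -/
def synth (R : ℕ) : CL2 n →L[ℝ] L2 n :=
  rePart.comp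
    (((Lp.fourierTransformₗᵢ (Space n) ℂ).symm.toContinuousLinearEquiv.toContinuousLinearMap
      |>.restrictScalars ℝ).comp (freqCut R))

theorem synth_apply (R : ℕ) (z : CL2 n) : synth R z = rePart (𝓕⁻ (freqCut R z)) := rfl

/-- `synth` cuts the frequencies anyway and the cutoff is idempotent, so the unbounded symbol can be
replaced by its bounded truncation. Iterating, band-limited functions lie in every H^k with bounds
in terms of ‖z‖. -/
theorem hasWeakDeriv_synth (R : ℕ) (i : Fin n) (z : CL2 n) :
    HasWeakDeriv i (synth R z) (synth R (symbCut R i z)) := by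
  rw [synth_apply, synth_apply]
  apply HasWeakDeriv.of_isSymbMul
  filter_upwards [coeFn_freqCut R z, coeFn_freqCut R (symbCut R i z), coeFn_symbCut R i z]
    with ξ h1 h2 h3
  rw [h2, h3, h1]
  linear_combination (symb i ξ * z ξ) * ballInd_mul_self R ξ

theorem weakDeriv_synth (R : ℕ) (i : Fin n) (z : CL2 n) :
    weakDeriv i (synth R z) = synth R (symbCut R i z) :=
  (hasWeakDeriv_synth R i z).weakDeriv_eq

theorem synth_mem_sobolev (R k : ℕ) (z : CL2 n) : synth R z ∈ sobolev n k := by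
  induction k generalizing z with
  | zero => exact Submodule.mem_top
  | succ k ih => exact fun i => ⟨_, ih _, hasWeakDeriv_synth R i z⟩

theorem exists_sobolevNorm_synth_le (R k : ℕ) :
    ∃ C : ℝ, ∀ z : CL2 n, sobolevNorm k (synth R z) ≤ C * ‖z‖ := by
  induction k with
  | zero => exact ⟨‖synth R‖, fun z => by rw [sobolevNorm_zero]; exact (synth R).le_opNorm z⟩
  | succ k ih =>
    obtain ⟨C, hC⟩ := ih
    refine ⟨‖synth (n := n) R‖ + ∑ i, |C| * ‖symbCut (n := n) R i‖, fun z => ?_⟩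
    refine (sobolevNorm_succ_le _ _).trans ?_
    rw [add_mul, Finset.sum_mul]
    refine add_le_add ((synth R).le_opNorm z) (Finset.sum_le_sum fun i _ => ?_)
    rw [weakDeriv_synth, mul_assoc]
    calc _ ≤ C * ‖symbCut R i z‖ := hC _
      _ ≤ |C| * ‖symbCut R i z‖ := by gcongr; exact le_abs_self C
      _ ≤ _ := by gcongr; exact (symbCut R i).le_opNorm z

/-- The band-limited function with the given frequencies, as an element of `H^k`. -/
def synthSobolev (R k : ℕ) : CL2 n →L[ℝ] SobolevSpace n k :=
  LinearMap.mkContinuous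
    { toFun := fun z => SobolevSpace.mk (synth R z) (synth_mem_sobolev R k z)
      map_add' := fun _ _ => SobolevSpace.toL2_injective (by simp)
      map_smul' := fun _ _ => SobolevSpace.toL2_injective (by simp) }
    (exists_sobolevNorm_synth_le R k).choose (exists_sobolevNorm_synth_le R k).choose_spec

@[simp]
theorem toL2_synthSobolev (R k : ℕ) (z : CL2 n) :
    SobolevSpace.toL2 (synthSobolev R k z) = synth R z := rfl

/-- The symbol of the Laplacian, restricted to frequencies of size at most `R`. -/
def lapCut (R : ℕ) : CL2 n →L[ℝ] CL2 n := ∑ i, (symbCut R i).comp (symbCut R i)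

theorem laplacian_synth (R : ℕ) (z : CL2 n) : laplacian (synth R z) = synth R (lapCut R z) := by
  simp [laplacian, lapCut, weakDeriv_synth]

/-- The orthogonal projection to the functions with frequencies of size at most `R`. -/
def bandProj (R : ℕ) (f : L2 n) : L2 n := synth R (𝓕 (toComplex f))

theorem HasWeakDeriv.bandProj {i : Fin n} {f g : L2 n} (h : HasWeakDeriv i f g) (R : ℕ) :
    weakDeriv i (bandProj R f) = _root_.bandProj R g := by
  -- The outer `freqCut` on the right is essential: outside the ball the left side is zero, while
  -- the transform of g need not be.
  have : freqCut R (symbCut R i (𝓕 (toComplex f))) = freqCut R (𝓕 (toComplex g)) := by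
    apply Lp.ext
    filter_upwards [h.isSymbMul, coeFn_freqCut R (symbCut R i (𝓕 (toComplex f))),
      coeFn_freqCut R (𝓕 (toComplex g)), coeFn_symbCut R i (𝓕 (toComplex f))] with ξ h1 h2 h3 h4
    rw [h2, h3, h1, h4]
    linear_combination (symb i ξ * (𝓕 (toComplex f) : CL2 n) ξ) * ballInd_mul_self R ξ
  rw [_root_.bandProj, weakDeriv_synth, synth_apply, this]
  rfl

/-- Dominated convergence for the squared modulus, with majorant |z|²: each frequency is eventually
inside the ball. -/
theorem tendsto_freqCut (z : CL2 n) : Tendsto (fun R => freqCut R z) atTop (𝓝 z) := by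
  rw [tendsto_iff_norm_sub_tendsto_zero]
  have hi : Integrable (fun ξ => ‖z ξ‖ ^ 2) := (Lp.memLp z).integrable_norm_pow (by norm_num)
  have h : Tendsto (fun R => ∫ ξ, ‖(freqCut R z - z : CL2 n) ξ‖ ^ 2) atTop
      (𝓝 (∫ _ : Space n, 0)) := by
    have hae : ∀ R, ∀ᵐ ξ, (freqCut R z - z : CL2 n) ξ = ballInd R ξ * z ξ - z ξ := by
      intro R
      filter_upwards [Lp.coeFn_sub (freqCut R z) z, coeFn_freqCut R z] with ξ h1 h2
      rw [h1, Pi.sub_apply, h2]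
    refine tendsto_integral_of_dominated_convergence _
      (fun R => ((Lp.memLp (freqCut R z - z)).1.norm.pow 2)) hi (fun R => ?_) ?_
    · filter_upwards [hae R] with ξ h1
      rw [h1, norm_pow, norm_norm]
      gcongr
      unfold ballInd
      by_cases h : ξ ∈ Metric.closedBall 0 (R : ℝ) <;> simp [h]
    · filter_upwards [ae_all_iff.2 hae] with ξ h1
      obtain ⟨N, hN⟩ := exists_nat_ge ‖ξ‖
      refine tendsto_const_nhds.congr' ?_
      filter_upwards [eventually_ge_atTop N] with R hR
      have : ξ ∈ Metric.closedBall 0 (R : ℝ) :=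
        mem_closedBall_zero_iff.2 (hN.trans (by exact_mod_cast hR))
      rw [h1, ballInd, indicator_of_mem this, Pi.one_apply, one_mul, sub_self, norm_zero,
        zero_pow two_ne_zero]
  rw [integral_zero] at h
  have e : ∀ w : CL2 n, ‖w‖ = √(∫ ξ, ‖w ξ‖ ^ 2) := by
    intro w
    have h1 : ((‖w‖ ^ 2 : ℝ) : ℂ) = ((∫ ξ, ‖w ξ‖ ^ 2 : ℝ) : ℂ) := by
      rw [← integral_complex_ofReal, Complex.ofReal_pow]
      refine (inner_self_eq_norm_sq_to_K (𝕜 := ℂ) w).symm.trans ?_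
      rw [MeasureTheory.L2.inner_def]
      refine integral_congr_ae (ae_of_all _ fun ξ => ?_)
      simp
    rw [← Complex.ofReal_injective h1, Real.sqrt_sq (norm_nonneg _)]
  simp only [e]
  rw [← Real.sqrt_zero]
  exact (Real.continuous_sqrt.tendsto 0).comp h

theorem tendsto_bandProj (f : L2 n) : Tendsto (fun R => bandProj R f) atTop (𝓝 f) := by
  have h := (rePart.continuous.comp
    (Lp.fourierTransformₗᵢ (Space n) ℂ).symm.continuous).tendsto (𝓕 (toComplex f))
  have := h.comp (tendsto_freqCut (𝓕 (toComplex f)))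
  rwa [Function.comp_apply, show rePart ((Lp.fourierTransformₗᵢ (Space n) ℂ).symm
    (𝓕 (toComplex f))) = f from rePart_fourierInv_fourier f] at this

/-- The projection commutes with weak derivatives, so convergence in H^k reduces to convergence in
L² of the derivatives. -/
theorem tendsto_sobolevNorm_bandProj {k : ℕ} {f : L2 n} (hf : f ∈ sobolev n k) :
    Tendsto (fun R => sobolevNorm k (bandProj R f - f)) atTop (𝓝 0) := by
  induction k generalizing f with
  | zero =>
    simp only [sobolevNorm_zero]
    exact tendsto_iff_norm_sub_tendsto_zero.1 (tendsto_bandProj f)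
  | succ k ih =>
    have h1 := (tendsto_iff_norm_sub_tendsto_zero.1 (tendsto_bandProj f)).add
      (tendsto_finsetSum Finset.univ fun i _ => ih (weakDeriv_mem_sobolev hf i))
    rw [Finset.sum_const_zero, add_zero] at h1
    refine squeeze_zero (fun _ => sobolevNorm_nonneg _ _) (fun R => ?_) h1
    refine (sobolevNorm_succ_le k _).trans_eq ?_
    congr 1
    refine Finset.sum_congr rfl fun i _ => ?_
    rw [weakDeriv_sub (f := bandProj R f) (synth_mem_sobolev R (k + 1) _) hf,
      (hasWeakDeriv_weakDeriv hf i).bandProj R]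

/-! ### Curves in Sobolev spaces and their time derivatives. -/

open SobolevSpace

theorem inC_zero_iff {k : ℕ} {u : ℝ → L2 n} : InC 0 k u ↔ ∃ U : ℝ → SobolevSpace n k,
    ContinuousOn U (Ici 0) ∧ ∀ t, 0 ≤ t → toL2 (U t) = u t := by
  simp [InC, contDiffOn_zero]

/-- `u ∈ C¹([0,∞), H^k)` with time derivative `v`. -/
def HasDtIn (k : ℕ) (u v : ℝ → L2 n) : Prop :=
  ∃ U V : ℝ → SobolevSpace n k, ContinuousOn V (Ici 0) ∧ ∀ t, 0 ≤ t →
    HasDerivWithinAt U (V t) (Ici 0) t ∧ toL2 (U t) = u t ∧ toL2 (V t) = v t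

/-- `op` is a total function on L², possibly meaningful only on H^k (such as `laplacian`); T is its
continuous realisation there. -/
theorem InC.map {j k : ℕ} {u : ℝ → L2 n} (h : InC 0 k u)
    (T : SobolevSpace n k →L[ℝ] SobolevSpace n j) {op : L2 n → L2 n}
    (hT : ∀ f, toL2 (T f) = op (toL2 f)) : InC 0 j fun t => op (u t) := by
  rw [inC_zero_iff] at h ⊢
  obtain ⟨U, hU, hu⟩ := h
  exact ⟨fun t => T (U t), T.continuous.comp_continuousOn hU, fun t ht => by rw [hT, hu t ht]⟩

theorem HasDtIn.map {j k : ℕ} {u v : ℝ → L2 n} (h : HasDtIn k u v)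
    (T : SobolevSpace n k →L[ℝ] SobolevSpace n j) {op : L2 n → L2 n}
    (hT : ∀ f, toL2 (T f) = op (toL2 f)) :
    HasDtIn j (fun t => op (u t)) fun t => op (v t) := by
  obtain ⟨U, V, hV, h⟩ := h
  refine ⟨fun t => T (U t), fun t => T (V t), T.continuous.comp_continuousOn hV, fun t ht => ?_⟩
  obtain ⟨h1, h2, h3⟩ := h t ht
  exact ⟨T.hasFDerivAt.comp_hasDerivWithinAt t h1, by rw [hT, h2], by rw [hT, h3]⟩

theorem HasDtIn.congr {k : ℕ} {u v u' v' : ℝ → L2 n} (h : HasDtIn k u v)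
    (hu : ∀ t, 0 ≤ t → u t = u' t) (hv : ∀ t, 0 ≤ t → v t = v' t) : HasDtIn k u' v' := by
  obtain ⟨U, V, hV, h⟩ := h
  refine ⟨U, V, hV, fun t ht => ?_⟩
  obtain ⟨h1, h2, h3⟩ := h t ht
  exact ⟨h1, h2.trans (hu t ht), h3.trans (hv t ht)⟩

theorem HasDtIn.sub {k : ℕ} {u v u' v' : ℝ → L2 n} (h : HasDtIn k u v) (h' : HasDtIn k u' v') :
    HasDtIn k (fun t => u t - u' t) fun t => v t - v' t := by
  obtain ⟨U, V, hV, h⟩ := h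
  obtain ⟨U', V', hV', h'⟩ := h'
  refine ⟨fun t => U t - U' t, fun t => V t - V' t, hV.sub hV', fun t ht => ?_⟩
  obtain ⟨h1, h2, h3⟩ := h t ht
  obtain ⟨h1', h2', h3'⟩ := h' t ht
  exact ⟨h1.sub h1', by rw [map_sub, h2, h2'], by rw [map_sub, h3, h3']⟩

theorem InC.sub {k : ℕ} {u u' : ℝ → L2 n} (h : InC 0 k u) (h' : InC 0 k u') :
    InC 0 k fun t => u t - u' t := by
  rw [inC_zero_iff] at h h' ⊢
  obtain ⟨U, hU, h⟩ := h
  obtain ⟨U', hU', h'⟩ := h'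
  exact ⟨fun t => U t - U' t, hU.sub hU', fun t ht => by rw [map_sub, h t ht, h' t ht]⟩

theorem InC.mem {k : ℕ} {u : ℝ → L2 n} (h : InC 0 k u) {t : ℝ} (ht : 0 ≤ t) :
    u t ∈ sobolev n k := by
  obtain ⟨U, _, h⟩ := h
  rw [← h t ht]
  exact toL2_mem _

theorem InC.continuousOn {k : ℕ} {u : ℝ → L2 n} (h : InC 0 k u) : ContinuousOn u (Ici 0) := by
  obtain ⟨U, hU, h⟩ := inC_zero_iff.1 h
  exact (toL2CLM.continuous.comp_continuousOn hU).congr fun t ht => (h t ht).symm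

theorem HasDtIn.inC_left {k : ℕ} {u v : ℝ → L2 n} (h : HasDtIn k u v) : InC 0 k u := by
  obtain ⟨U, V, hV, h⟩ := h
  exact inC_zero_iff.2 ⟨U, fun t ht => (h t ht).1.continuousWithinAt, fun t ht => (h t ht).2.1⟩

theorem HasDtIn.inC_right {k : ℕ} {u v : ℝ → L2 n} (h : HasDtIn k u v) : InC 0 k v := by
  obtain ⟨U, V, hV, h⟩ := h
  exact inC_zero_iff.2 ⟨V, hV, fun t ht => (h t ht).2.2⟩

/-- The inclusion of H^k in L² is continuous, so a derivative in the H^k norm is also the L²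
derivative computed by `dt`. -/
theorem HasDtIn.hasDerivWithinAt {k : ℕ} {u v : ℝ → L2 n} (h : HasDtIn k u v) {t : ℝ}
    (ht : 0 ≤ t) : HasDerivWithinAt u (v t) (Ici 0) t := by
  obtain ⟨U, V, hV, h⟩ := h
  rw [← (h t ht).2.2]
  exact (toL2CLM.hasFDerivAt.comp_hasDerivWithinAt t (h t ht).1).congr
    (fun s hs => ((h s hs).2.1).symm) ((h t ht).2.1).symm

theorem HasDtIn.dt_eq {k : ℕ} {u v : ℝ → L2 n} (h : HasDtIn k u v) {t : ℝ} (ht : 0 ≤ t) :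
    dt u t = v t :=
  (h.hasDerivWithinAt ht).derivWithin (uniqueDiffOn_Ici 0 t ht)

theorem HasDtIn.inC_one {k : ℕ} {u v : ℝ → L2 n} (h : HasDtIn k u v) : InC 1 k u := by
  obtain ⟨U, V, hV, h⟩ := h
  refine ⟨U, ?_, fun t ht => (h t ht).2.1⟩
  rw [Nat.cast_one, contDiffOn_one_iff_derivWithin (uniqueDiffOn_Ici 0)]
  exact ⟨fun t ht => (h t ht).1.differentiableWithinAt, hV.congr fun t ht =>
    (h t ht).1.derivWithin (uniqueDiffOn_Ici 0 t ht)⟩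

theorem InC.hasDtIn {k : ℕ} {u : ℝ → L2 n} (h : InC 1 k u) : HasDtIn k u (dt u) := by
  obtain ⟨U, hU, h⟩ := h
  rw [Nat.cast_one, contDiffOn_one_iff_derivWithin (uniqueDiffOn_Ici 0)] at hU
  have h0 : HasDtIn k u fun t => toL2 (derivWithin U (Ici 0) t) :=
    ⟨U, _, hU.2, fun t ht => ⟨(hU.1 t ht).hasDerivWithinAt, h t ht, rfl⟩⟩
  exact h0.congr (fun _ _ => rfl) fun t ht => (h0.dt_eq ht).symm

theorem InC.hasDtIn_dt {k : ℕ} {u : ℝ → L2 n} (h : InC 2 k u) : HasDtIn k (dt u) (dt (dt u)) := by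
  obtain ⟨U, hU, h⟩ := h
  have hU' := ((contDiffOn_succ_iff_derivWithin (n := 1) (uniqueDiffOn_Ici 0)).1 hU)
  have h0 : HasDtIn k u fun t => toL2 (derivWithin U (Ici 0) t) :=
    ⟨U, _, hU'.2.2.continuousOn, fun t ht => ⟨(hU'.1 t ht).hasDerivWithinAt, h t ht, rfl⟩⟩
  exact InC.hasDtIn ⟨_, hU'.2.2, fun t ht => (h0.dt_eq ht).symm⟩

theorem HasDtIn.inC_two {k : ℕ} {u v w : ℝ → L2 n} (h : HasDtIn k u v) (h' : HasDtIn k v w) :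
    InC 2 k u := by
  obtain ⟨U, V, hV, h⟩ := h
  obtain ⟨V', hV'c, h'⟩ := h'.inC_one
  refine ⟨U, ?_, fun t ht => (h t ht).2.1⟩
  refine (contDiffOn_succ_iff_derivWithin (n := 1) (uniqueDiffOn_Ici 0)).2
    ⟨fun t ht => (h t ht).1.differentiableWithinAt, by simp, hV'c.congr fun t ht => ?_⟩
  rw [(h t ht).1.derivWithin (uniqueDiffOn_Ici 0 t ht)]
  exact toL2_injective (((h t ht).2.2).trans (h' t ht).symm)

/-! ### Regular solutions and the operations preserving them. -/

/-- `u` is a solution of the damped wave equation in `C([0,∞), H^{k+2}) ∩ C¹([0,∞), H^{k+1})`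
with `∂ₜu = v ∈ C¹([0,∞), H^k)`. -/
structure IsRegularSolution (μ : ℝ) (k : ℕ) (u v : ℝ → L2 n) : Prop where
  cont : InC 0 (k + 2) u
  hasDt : HasDtIn (k + 1) u v
  hasDt_dt : HasDtIn k v fun t => laplacian (u t) - (μ / (1 + t)) • v t

theorem continuousOn_damping (μ : ℝ) : ContinuousOn (fun t : ℝ => μ / (1 + t)) (Ici 0) :=
  continuousOn_const.div (by fun_prop) fun t (ht : 0 ≤ t) => by positivity

/-- The equation is imposed only for t > 0, but both sides are continuous in L² on [0,∞), so it
extends to t = 0. -/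
theorem IsStrongSolution.isRegularSolution {μ : ℝ} {u₀ u₁ : L2 n} {u : ℝ → L2 n}
    (h : IsStrongSolution μ u₀ u₁ u) : IsRegularSolution μ 0 u (dt u) := by
  have h1 := h.mem_C1_H1.hasDtIn
  have h2 := h.mem_C2_L2.hasDtIn_dt
  refine ⟨h.mem_C0_H2, h1, h2.congr (fun _ _ => rfl) ?_⟩
  have hcl : closure (Ioi (0 : ℝ)) = Ici 0 := closure_Ioi 0
  have e : EqOn (dt (dt u)) (fun t => laplacian (u t) - (μ / (1 + t)) • dt u t) (Ioi 0) :=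
    fun t ht => by
      have := h.equation t ht
      rw [sub_add, sub_eq_zero] at this
      exact this
  refine e.of_subset_closure h2.inC_right.continuousOn ?_ Ioi_subset_Ici_self hcl.ge
  exact (h.mem_C0_H2.map (j := 0) lap toL2_lap).continuousOn.sub
    ((continuousOn_damping μ).smul h1.inC_right.continuousOn)

theorem IsRegularSolution.isStrongSolution {μ : ℝ} {u v : ℝ → L2 n}
    (h : IsRegularSolution μ 0 u v) : IsStrongSolution μ (u 0) (v 0) u where
  mem_C0_H2 := h.cont
  mem_C1_H1 := h.hasDt.inC_one
  mem_C2_L2 := (h.hasDt.map incl (op := id) fun _ => rfl).inC_two h.hasDt_dt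
  init := rfl
  init_dt := h.hasDt.dt_eq le_rfl
  equation t ht := by
    have e : dt (dt u) t = dt v t :=
      derivWithin_congr (fun s hs => h.hasDt.dt_eq hs) (h.hasDt.dt_eq ht.le)
    rw [e, h.hasDt_dt.dt_eq ht.le, h.hasDt.dt_eq ht.le]
    abel

theorem IsRegularSolution.sub {μ : ℝ} {u v u' v' : ℝ → L2 n} {k : ℕ}
    (h : IsRegularSolution μ k u v) (h' : IsRegularSolution μ k u' v') :
    IsRegularSolution μ k (fun t => u t - u' t) fun t => v t - v' t where
  cont := h.cont.sub h'.cont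
  hasDt := h.hasDt.sub h'.hasDt
  hasDt_dt := (h.hasDt_dt.sub h'.hasDt_dt).congr (fun _ _ => rfl) fun t ht => by
    rw [laplacian_sub (sobolev_mono (by omega) (h.cont.mem ht))
      (sobolev_mono (by omega) (h'.cont.mem ht))]
    module

theorem weakDeriv_comm {f : L2 n} (hf : f ∈ sobolev n 2) (i j : Fin n) :
    weakDeriv i (weakDeriv j f) = weakDeriv j (weakDeriv i f) :=
  ((hasWeakDeriv_weakDeriv hf i).comm (hasWeakDeriv_weakDeriv hf j)
    (hasWeakDeriv_weakDeriv (weakDeriv_mem_sobolev hf i) j)).weakDeriv_eq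

theorem weakDeriv_laplacian {f : L2 n} (hf : f ∈ sobolev n 3) (i : Fin n) :
    weakDeriv i (laplacian f) = laplacian (weakDeriv i f) := by
  have hs : ∀ j, weakDeriv j (weakDeriv j f) ∈ sobolev n 1 := fun j =>
    weakDeriv_mem_sobolev (weakDeriv_mem_sobolev hf j) j
  have h := congrArg toL2 (map_sum (SobolevSpace.deriv (k := 0) i)
    (fun j => SobolevSpace.mk _ (hs j)) Finset.univ)
  rw [toL2_deriv, map_sum, map_sum] at h
  refine h.trans (Finset.sum_congr rfl fun j _ => ?_)
  rw [toL2_deriv, toL2_mk, weakDeriv_comm (weakDeriv_mem_sobolev hf j),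
    weakDeriv_comm (sobolev_succ_le 2 hf) i j]

/-- ∂ᵢ commutes with Δ and the damping coefficient is constant in space, so the equation is
preserved at the cost of one order of regularity. -/
theorem IsRegularSolution.weakDeriv {μ : ℝ} {u v : ℝ → L2 n} {k : ℕ}
    (h : IsRegularSolution μ (k + 1) u v) (i : Fin n) :
    IsRegularSolution μ k (fun t => weakDeriv i (u t)) fun t => weakDeriv i (v t) where
  cont := h.cont.map (SobolevSpace.deriv i) fun _ => rfl
  hasDt := h.hasDt.map (SobolevSpace.deriv i) fun _ => rfl
  hasDt_dt := (h.hasDt_dt.map (SobolevSpace.deriv i) fun _ => rfl).congr (fun _ _ => rfl)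
    fun t ht => by
      have hu : u t ∈ sobolev n (k + 3) := h.cont.mem ht
      have hv : v t ∈ sobolev n (k + 1) := h.hasDt_dt.inC_left.mem ht
      rw [← weakDeriv_laplacian (sobolev_mono (by omega) hu),
        weakDeriv_sub (laplacian_mem_sobolev hu) (Submodule.smul_mem _ _ hv),
        ((hasWeakDeriv_weakDeriv hv i).smul _).weakDeriv_eq]

theorem IsRegularSolution.laplacian {μ : ℝ} {u v : ℝ → L2 n} {k : ℕ}
    (h : IsRegularSolution μ (k + 2) u v) :
    IsRegularSolution μ k (fun t => laplacian (u t)) fun t => laplacian (v t) where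
  cont := h.cont.map lap toL2_lap
  hasDt := h.hasDt.map (lap (k := k + 1)) toL2_lap
  hasDt_dt := (h.hasDt_dt.map lap toL2_lap).congr (fun _ _ => rfl) fun t ht => by
    have hu : u t ∈ sobolev n (k + 4) := h.cont.mem ht
    have hv : v t ∈ sobolev n (k + 2) := h.hasDt_dt.inC_left.mem ht
    have h1 := congrArg toL2 (map_sub lap (SobolevSpace.mk _ (laplacian_mem_sobolev hu))
      ((μ / (1 + t)) • SobolevSpace.mk _ hv))
    rw [map_smul, toL2_lap, map_sub, map_sub, map_smul, map_smul, toL2_lap, toL2_lap] at h1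
    exact h1

theorem IsRegularSolution.of_succ {μ : ℝ} {u v : ℝ → L2 n} {k : ℕ}
    (h : IsRegularSolution μ (k + 1) u v) : IsRegularSolution μ k u v where
  cont := h.cont.map incl (op := id) fun _ => rfl
  hasDt := h.hasDt.map incl (op := id) fun _ => rfl
  hasDt_dt := h.hasDt_dt.map incl (op := id) fun _ => rfl

/-! ### Decay of the weighted energy. -/

/-- The weighted energy at time `t` of a function with value `f` and time derivative `g`. -/
def energy (t : ℝ) (f g : L2 n) : ℝ := ‖f‖ ^ 2 / (1 + t) ^ 2 + ‖g‖ ^ 2 + derivNorm 1 f ^ 2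

theorem energy_nonneg (t : ℝ) (f g : L2 n) : 0 ≤ energy t f g := by
  unfold energy; positivity

/-- The abstract energy lemmas with pᵢ = ∂ᵢu and qᵢ = ∂ᵢv; integration by parts supplies their two
identities. The constant is the ratio of the two equivalence constants, which do not involve n. -/
theorem exists_energy_decay {μ η : ℝ} (hμ : 0 < μ) (hη₀ : 0 < η) (hη₂ : η < 2) :
    ∃ C : ℝ, 0 < C ∧ ∀ (n : ℕ) (u v : ℝ → L2 n), IsRegularSolution μ 0 u v →
      ∀ s t : ℝ, 0 ≤ s → s ≤ t →
        energy t (u t) (v t) ≤ C * ((1 + s) / (1 + t)) ^ alpha0 μ η * energy s (u s) (v s) := by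
  obtain ⟨hα₀, hαμ, hα₂, hγ⟩ := alpha0_bounds hμ hη₀ hη₂
  set α := alpha0 μ η
  set γ := α * (1 + μ - α) / 2 with hγd
  have hγ0 : 0 < γ := lt_of_le_of_lt (by positivity) hγ
  obtain ⟨m, hm0, hm1, hm2⟩ : ∃ m : ℝ, 0 < m ∧ m ≤ 1 / 2 ∧ m ≤ (γ - α ^ 2 / 4) / 3 :=
    ⟨min (1 / 2) ((γ - α ^ 2 / 4) / 3), lt_min (by norm_num) (by linarith), min_le_left _ _,
      min_le_right _ _⟩
  refine ⟨(1 + α + γ) / m, by positivity, fun n u v h s t hs hst => ?_⟩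
  have ht : 0 ≤ t := hs.trans hst
  have hmem : ∀ t, 0 ≤ t → u t ∈ sobolev n 2 := fun t ht => h.cont.mem ht
  have hmem' : ∀ t, 0 ≤ t → v t ∈ sobolev n 1 := fun t ht => h.hasDt.inC_right.mem ht
  have hp : ∀ i, HasDtIn 0 (fun t => weakDeriv i (u t)) fun t => weakDeriv i (v t) := fun i =>
    h.hasDt.map (SobolevSpace.deriv i) fun _ => rfl
  have hA := modifiedEnergy_antitoneOn hα₀ hαμ hα₂ hγd
    (fun t ht => (h.hasDt.hasDerivWithinAt ht.le).hasDerivAt (Ici_mem_nhds ht))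
    (fun t ht => (h.hasDt_dt.hasDerivWithinAt ht.le).hasDerivAt (Ici_mem_nhds ht))
    (fun i t ht => ((hp i).hasDerivWithinAt ht.le).hasDerivAt (Ici_mem_nhds ht))
    h.cont.continuousOn h.hasDt_dt.inC_left.continuousOn
    (fun i => (hp i).inC_left.continuousOn)
    (fun t ht => by
      rw [_root_.laplacian, sum_inner, ← Finset.sum_neg_distrib]
      refine Finset.sum_congr rfl fun i _ => ?_
      rw [(hasWeakDeriv_weakDeriv (weakDeriv_mem_sobolev (hmem t ht.le) i) i).inner_eq
        (hasWeakDeriv_weakDeriv (hmem' t ht.le) i), neg_neg])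
    (fun t ht => by
      rw [_root_.laplacian, sum_inner, ← Finset.sum_neg_distrib]
      refine Finset.sum_congr rfl fun i _ => ?_
      rw [(hasWeakDeriv_weakDeriv (weakDeriv_mem_sobolev (hmem t ht.le) i) i).inner_eq
        (hasWeakDeriv_weakDeriv (hmem t ht.le) i), neg_neg, real_inner_self_eq_norm_sq])
    hs ht hst
  simp only [← derivNorm_one_sq] at hA
  have e1 := (modifiedEnergy_equiv hα₀ hα₂ hγ hm0 hm1 hm2 (u t) (v t)
    (show 0 < 1 + t by linarith) (sq_nonneg (derivNorm 1 (u t)))).1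
  have e2 := (modifiedEnergy_equiv hα₀ hα₂ hγ hm0 hm1 hm2 (u s) (v s)
    (show 0 < 1 + s by linarith) (sq_nonneg (derivNorm 1 (u s)))).2
  have p1 : 0 < (1 + t) ^ α := Real.rpow_pos_of_pos (by linarith) _
  have p2 : 0 < (1 + s) ^ α := Real.rpow_pos_of_pos (by linarith) _
  have f1 := mul_le_mul_of_nonneg_left e1 p1.le
  have f2 := mul_le_mul_of_nonneg_left e2 p2.le
  have f := f1.trans (hA.trans f2)
  rw [Real.div_rpow (by linarith) (by linarith), energy, energy]
  have hm := mul_pos p1 hm0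
  calc _ = (1 + t) ^ α * (m * (‖u t‖ ^ 2 / (1 + t) ^ 2 + ‖v t‖ ^ 2 + derivNorm 1 (u t) ^ 2)) /
        ((1 + t) ^ α * m) := by field_simp
    _ ≤ _ := (div_le_div_iff_of_pos_right hm).2 f
    _ = _ := by field_simp

/-! ### Existence for band-limited data. -/

/-- Band-limited data have smooth solutions. -/
theorem exists_isRegularSolution_bandProj (μ : ℝ) (R : ℕ) (u₀ u₁ : L2 n) :
    ∃ u v : ℝ → L2 n, (∀ k, IsRegularSolution μ k u v) ∧ u 0 = bandProj R u₀ ∧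
      v 0 = bandProj R u₁ := by
  let A₀ : CL2 n × CL2 n →L[ℝ] CL2 n × CL2 n :=
    (ContinuousLinearMap.snd ℝ _ _).prod ((lapCut R).comp (ContinuousLinearMap.fst ℝ _ _))
  let A₁ : CL2 n × CL2 n →L[ℝ] CL2 n × CL2 n :=
    (0 : CL2 n × CL2 n →L[ℝ] CL2 n).prod (-ContinuousLinearMap.snd ℝ _ _)
  -- The ODE theorem wants coefficients bounded on all of ℝ, so the damping is frozen for t < 0.
  have hpos : ∀ t : ℝ, 0 < 1 + max t 0 := fun t => by positivity
  obtain ⟨X, hX0, hX⟩ := exists_hasDerivAt_linear (L := fun t => A₀ + (μ / (1 + max t 0)) • A₁)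
    (continuous_const.add ((continuous_const.div (by fun_prop) fun t => (hpos t).ne').smul
      continuous_const)) (K := ‖A₀‖ + |μ| * ‖A₁‖) (fun t => by
        refine (norm_add_le _ _).trans ?_
        rw [norm_smul, norm_div, Real.norm_eq_abs, Real.norm_of_nonneg (hpos t).le]
        gcongr
        exact div_le_self (abs_nonneg _) (by simp))
    -- The full transforms serve as initial values: `synth` truncates them and so yields `bandProj`
    -- of the data.
    (Lp.fourierTransformₗᵢ (Space n) ℂ (toComplex u₀),
      Lp.fourierTransformₗᵢ (Space n) ℂ (toComplex u₁))
  have h1 : ∀ t, 0 ≤ t → HasDerivAt (fun t => (X t).1) (X t).2 t := fun t ht =>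
    ((ContinuousLinearMap.fst ℝ (CL2 n) (CL2 n)).hasFDerivAt.comp_hasDerivAt t
      (hX t ht)).congr_deriv (by simp [A₀, A₁])
  have h2 : ∀ t, 0 ≤ t → HasDerivAt (fun t => (X t).2)
      (lapCut R (X t).1 - (μ / (1 + t)) • (X t).2) t := fun t ht =>
    ((ContinuousLinearMap.snd ℝ (CL2 n) (CL2 n)).hasFDerivAt.comp_hasDerivAt t
      (hX t ht)).congr_deriv (by simp [A₀, A₁, max_eq_left ht, sub_eq_add_neg])
  have c1 : ContinuousOn (fun t => (X t).1) (Ici 0) := fun t ht =>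
    (h1 t ht).continuousAt.continuousWithinAt
  have c2 : ContinuousOn (fun t => (X t).2) (Ici 0) := fun t ht =>
    (h2 t ht).continuousAt.continuousWithinAt
  refine ⟨fun t => synth R (X t).1, fun t => synth R (X t).2, fun k => ⟨?_, ?_, ?_⟩, ?_, ?_⟩
  · exact inC_zero_iff.2 ⟨fun t => synthSobolev R (k + 2) (X t).1,
      (synthSobolev R (k + 2)).continuous.comp_continuousOn c1, fun _ _ => rfl⟩
  · exact ⟨fun t => synthSobolev R (k + 1) (X t).1, fun t => synthSobolev R (k + 1) (X t).2,
      (synthSobolev R (k + 1)).continuous.comp_continuousOn c2, fun t ht =>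
      ⟨((synthSobolev R (k + 1)).hasFDerivAt.comp_hasDerivAt t (h1 t ht)).hasDerivWithinAt,
        rfl, rfl⟩⟩
  · refine ⟨fun t => synthSobolev R k (X t).2,
      fun t => synthSobolev R k (lapCut R (X t).1 - (μ / (1 + t)) • (X t).2),
      (synthSobolev R k).continuous.comp_continuousOn
        (((lapCut R).continuous.comp_continuousOn c1).sub ((continuousOn_damping μ).smul c2)),
      fun t ht =>
      ⟨((synthSobolev R k).hasFDerivAt.comp_hasDerivAt t (h2 t ht)).hasDerivWithinAt,
        rfl, ?_⟩⟩
    simp only [toL2_synthSobolev, map_sub, map_smul, laplacian_synth]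
  · simp only [hX0]; rfl
  · simp only [hX0]; rfl

/-! ### Bounds in H^(k+1) × H^k on bounded time intervals. -/

theorem sobolevNorm_one (f : L2 n) : sobolevNorm 1 f = ‖f‖ + derivNorm 1 f := by
  simp [sobolevNorm, Finset.sum_range_succ, derivNorm_zero]

theorem gradSobolevNorm_one (f : L2 n) : gradSobolevNorm 1 f = derivNorm 1 f + derivNorm 2 f := by
  simp [gradSobolevNorm, Finset.sum_range_succ]

theorem sobolevNorm_sub_le {k : ℕ} {f g h : L2 n} (hf : f ∈ sobolev n k) (hg : g ∈ sobolev n k)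
    (hh : h ∈ sobolev n k) : sobolevNorm k (f - h) ≤ sobolevNorm k (f - g) + sobolevNorm k (g - h) :=
  norm_sub_le_norm_sub_add_norm_sub (SobolevSpace.mk f hf) (SobolevSpace.mk g hg)
    (SobolevSpace.mk h hh)

theorem sobolevNorm_sub_comm {k : ℕ} {f g : L2 n} (hf : f ∈ sobolev n k) (hg : g ∈ sobolev n k) :
    sobolevNorm k (f - g) = sobolevNorm k (g - f) :=
  norm_sub_rev (SobolevSpace.mk f hf) (SobolevSpace.mk g hg)

/-- On bounded time intervals the solution is controlled by its data. -/
theorem exists_sobolevNorm_bound {μ : ℝ} (hμ : 0 < μ) (n k : ℕ) (T : ℝ) :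
    ∃ C : ℝ, 0 ≤ C ∧ ∀ u v : ℝ → L2 n, IsRegularSolution μ k u v → ∀ t ∈ Icc 0 T,
      sobolevNorm (k + 1) (u t) + sobolevNorm k (v t) ≤
        C * (sobolevNorm (k + 1) (u 0) + sobolevNorm k (v 0)) := by
  induction k with
  | zero =>
    obtain ⟨C, hC, h⟩ := exists_energy_decay hμ one_pos one_lt_two
    -- With D the norm of the data, ‖u‖ costs (1+|T|)√C D because of its weight, and ‖v‖ and ‖∇u‖
    -- cost √C D each. Decay is not needed here, so η = 1 will do.
    refine ⟨(|T| + 3) * √C, by positivity, fun u v huv t ht => ?_⟩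
    have hα := (alpha0_bounds hμ one_pos one_lt_two).1
    have h1 := h n u v huv 0 t le_rfl ht.1
    have ht1 : (1 : ℝ) ≤ 1 + t := by linarith [ht.1]
    have h2 : ((1 + 0) / (1 + t)) ^ alpha0 μ 1 ≤ 1 := by
      refine Real.rpow_le_one (by positivity) ?_ hα
      rw [div_le_one (by positivity)]
      linarith
    simp only [zero_add, sobolevNorm_one, sobolevNorm_zero]
    set D := ‖u 0‖ + derivNorm 1 (u 0) + ‖v 0‖ with hD
    have d0 := derivNorm_nonneg 1 (u 0)
    have hD0 : 0 ≤ D := by positivity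
    have h3 : energy 0 (u 0) (v 0) ≤ D ^ 2 := by
      simp only [energy, add_zero, one_pow, div_one, hD]
      nlinarith [norm_nonneg (u 0), norm_nonneg (v 0), mul_nonneg (norm_nonneg (u 0)) d0,
        mul_nonneg (norm_nonneg (v 0)) d0, mul_nonneg (norm_nonneg (u 0)) (norm_nonneg (v 0))]
    have h4 : energy t (u t) (v t) ≤ (√C * D) ^ 2 := by
      rw [mul_pow, Real.sq_sqrt hC.le]
      refine h1.trans (mul_le_mul ?_ h3 (energy_nonneg _ _ _) hC.le)
      exact mul_le_of_le_one_right hC.le h2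
    have hs : 0 ≤ √C * D := by positivity
    have q1 : 0 ≤ ‖u t‖ ^ 2 / (1 + t) ^ 2 := by positivity
    have e1 : ‖u t‖ / (1 + t) ≤ √C * D := by
      refine le_of_sq_le_sq ?_ hs
      rw [div_pow]
      refine le_trans ?_ h4
      unfold energy
      nlinarith [sq_nonneg ‖v t‖, sq_nonneg (derivNorm 1 (u t))]
    have e2 : ‖v t‖ ≤ √C * D := by
      refine le_of_sq_le_sq (le_trans ?_ h4) hs
      unfold energy
      nlinarith [sq_nonneg ‖v t‖, sq_nonneg (derivNorm 1 (u t))]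
    have e3 : derivNorm 1 (u t) ≤ √C * D := by
      refine le_of_sq_le_sq (le_trans ?_ h4) hs
      unfold energy
      nlinarith [sq_nonneg ‖v t‖, sq_nonneg (derivNorm 1 (u t))]
    rw [div_le_iff₀ (by positivity)] at e1
    have e4 : √C * D * (1 + t) ≤ √C * D * (1 + |T|) := by
      gcongr
      exact ht.2.trans (le_abs_self T)
    nlinarith
  | succ k ih =>
    obtain ⟨C, hC, h⟩ := ih
    -- One contribution of u itself and one of each of the n derivatives ∂ᵢu.
    refine ⟨C * (1 + n), by positivity, fun u v huv t ht => ?_⟩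
    have h0 := h u v huv.of_succ t ht
    have hi := fun i => h _ _ (huv.weakDeriv i) t ht
    set D := sobolevNorm (k + 1 + 1) (u 0) + sobolevNorm (k + 1) (v 0) with hD
    have hi' : ∀ i, sobolevNorm (k + 1) (weakDeriv i (u t)) + sobolevNorm k (weakDeriv i (v t)) ≤
        C * D := fun i => (hi i).trans <| by
      gcongr
      exact add_le_add (sobolevNorm_weakDeriv_le _ _ _) (sobolevNorm_weakDeriv_le _ _ _)
    have h0' : ‖u t‖ + ‖v t‖ ≤ C * D := by
      refine (add_le_add (norm_le_sobolevNorm _ _) (norm_le_sobolevNorm _ _)).trans (h0.trans ?_)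
      gcongr
      exact add_le_add (sobolevNorm_le_succ _ _) (sobolevNorm_le_succ _ _)
    have hsum := Finset.sum_le_sum fun i (_ : i ∈ Finset.univ) => hi' i
    rw [Finset.sum_add_distrib, Finset.sum_const, Finset.card_univ, Fintype.card_fin,
      nsmul_eq_mul] at hsum
    have a1 := sobolevNorm_succ_le (k + 1) (u t)
    have a2 := sobolevNorm_succ_le k (v t)
    linarith

/-! ### Locally uniform limits of solutions. -/

theorem exists_continuousOn_limit {X : Type*} [NormedAddCommGroup X] [CompleteSpace X] {W : ℕ → ℝ → X} (hW : ∀ j, ContinuousOn (W j) (Ici 0))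
    (hC : ∀ T, UniformCauchySeqOn W atTop (Icc 0 T)) :
    ∃ U : ℝ → X, ContinuousOn U (Ici 0) ∧ ∀ T, TendstoUniformlyOn W U atTop (Icc 0 T) := by
  have h : ∀ t : ℝ, ∃ x, 0 ≤ t → Tendsto (fun j => W j t) atTop (𝓝 x) := by
    intro t
    by_cases ht : 0 ≤ t
    · obtain ⟨x, hx⟩ := cauchySeq_tendsto_of_complete ((hC t).cauchySeq ⟨ht, le_rfl⟩)
      exact ⟨x, fun _ => hx⟩
    · exact ⟨0, fun h => absurd h ht⟩
  choose U hU using h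
  have hT : ∀ T, TendstoUniformlyOn W U atTop (Icc 0 T) := fun T =>
    (hC T).tendstoUniformlyOn_of_tendsto fun t ht => hU t ht.1
  refine ⟨U, fun t ht => ?_, hT⟩
  have hc : ContinuousOn U (Icc 0 (t + 1)) :=
    (hT (t + 1)).continuousOn (Frequently.of_forall fun j => (hW j).mono fun s hs => hs.1)
  refine (hc t ⟨ht, by linarith⟩).mono_of_mem_nhdsWithin ?_
  filter_upwards [self_mem_nhdsWithin, mem_nhdsWithin_of_mem_nhds (Iic_mem_nhds (lt_add_one t))]
    with s h1 h2 using ⟨h1, h2⟩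

/-- Pass to the limit in W(t) = W(0) + ∫V and differentiate the result. Composing with `max s 0`
makes the integrands continuous on all of ℝ. -/
theorem hasDerivWithinAt_of_limit {X : Type*} [NormedAddCommGroup X] [NormedSpace ℝ X]
    [CompleteSpace X] {W V : ℕ → ℝ → X} {U V' : ℝ → X}
    (hW : ∀ j t, 0 ≤ t → HasDerivWithinAt (W j) (V j t) (Ici 0) t)
    (hV : ∀ j, ContinuousOn (V j) (Ici 0)) (hV' : ContinuousOn V' (Ici 0))
    (hU : ∀ t, 0 ≤ t → Tendsto (fun j => W j t) atTop (𝓝 (U t)))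
    (hVV' : ∀ T, TendstoUniformlyOn V V' atTop (Icc 0 T)) {t : ℝ} (ht : 0 ≤ t) :
    HasDerivWithinAt U (V' t) (Ici 0) t := by
  have hmax : ContinuousOn (fun s : ℝ => max s 0) univ := by fun_prop
  have hc : Continuous fun s => V' (max s 0) :=
    continuousOn_univ.1 (hV'.comp hmax fun s _ => le_max_right s 0)
  have key : ∀ t, 0 ≤ t → U t = U 0 + ∫ s in (0 : ℝ)..t, V' (max s 0) := by
    intro t ht
    have hcj : ∀ j, Continuous fun s => V j (max s 0) := fun j =>
      continuousOn_univ.1 ((hV j).comp hmax fun s _ => le_max_right s 0)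
    have e : ∀ j, W j t = W j 0 + ∫ s in (0 : ℝ)..t, V j (max s 0) := by
      intro j
      rw [intervalIntegral.integral_eq_sub_of_hasDerivAt_of_le ht
        (f := W j) (fun s hs => ((hW j s hs.1).continuousWithinAt).mono fun r hr => hr.1)
        (fun s hs => by
          rw [max_eq_left hs.1.le]
          exact (hW j s hs.1.le).hasDerivAt (Ici_mem_nhds hs.1))
        ((hcj j).intervalIntegrable _ _)]
      abel
    have lim : Tendsto (fun j => ∫ s in (0 : ℝ)..t, V j (max s 0)) atTop
        (𝓝 (∫ s in (0 : ℝ)..t, V' (max s 0))) := by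
      rw [Metric.tendsto_atTop]
      intro ε hε
      have hu := Metric.tendstoUniformlyOn_iff.1 (hVV' t) (ε / (t + 1)) (by positivity)
      obtain ⟨N, hN⟩ := eventually_atTop.1 hu
      refine ⟨N, fun j hj => ?_⟩
      rw [dist_eq_norm, ← intervalIntegral.integral_sub ((hcj j).intervalIntegrable _ _)
        (hc.intervalIntegrable _ _)]
      refine (intervalIntegral.norm_integral_le_of_norm_le_const (C := ε / (t + 1))
        fun s hs => ?_).trans_lt ?_
      · rw [uIoc_of_le ht] at hs
        rw [max_eq_left hs.1.le, ← dist_eq_norm, dist_comm]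
        exact (hN j hj s ⟨hs.1.le, hs.2⟩).le
      · rw [sub_zero, abs_of_nonneg ht, div_mul_eq_mul_div, div_lt_iff₀ (by positivity)]
        nlinarith
    exact tendsto_nhds_unique (hU t ht) (((hU 0 le_rfl).add lim).congr fun j => (e j).symm)
  have hd : HasDerivAt (fun t => U 0 + ∫ s in (0 : ℝ)..t, V' (max s 0)) (V' (max t 0)) t :=
    (hc.integral_hasStrictDerivAt 0 t).hasDerivAt.const_add _
  rw [max_eq_left ht] at hd
  exact hd.hasDerivWithinAt.congr (fun s hs => key s hs) (key t ht)

/-- `w j → u` in `C([0,T], H^k)` for every `T`. -/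
def ConvergesIn (k : ℕ) (w : ℕ → ℝ → L2 n) (u : ℝ → L2 n) : Prop :=
  ∃ (W : ℕ → ℝ → SobolevSpace n k) (U : ℝ → SobolevSpace n k),
    (∀ j t, 0 ≤ t → toL2 (W j t) = w j t) ∧ (∀ t, 0 ≤ t → toL2 (U t) = u t) ∧
    (∀ j, ContinuousOn (W j) (Ici 0)) ∧ ContinuousOn U (Ici 0) ∧
    ∀ T, TendstoUniformlyOn W U atTop (Icc 0 T)

namespace ConvergesIn

variable {k : ℕ} {w : ℕ → ℝ → L2 n} {u : ℝ → L2 n}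

theorem map {j : ℕ} (h : ConvergesIn k w u) (T : SobolevSpace n k →L[ℝ] SobolevSpace n j)
    {op : L2 n → L2 n} (hT : ∀ f, toL2 (T f) = op (toL2 f)) :
    ConvergesIn j (fun i t => op (w i t)) fun t => op (u t) := by
  obtain ⟨W, U, h1, h2, h3, h4, h5⟩ := h
  exact ⟨fun i t => T (W i t), fun t => T (U t), fun i t ht => by rw [hT, h1 i t ht],
    fun t ht => by rw [hT, h2 t ht], fun i => T.continuous.comp_continuousOn (h3 i),
    T.continuous.comp_continuousOn h4, fun R => T.uniformContinuous.comp_tendstoUniformlyOn (h5 R)⟩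

theorem inC (h : ConvergesIn k w u) : InC 0 k u := by
  obtain ⟨W, U, h1, h2, h3, h4, h5⟩ := h
  exact inC_zero_iff.2 ⟨U, h4, h2⟩

theorem tendsto_sobolev (h : ConvergesIn k w u) {t : ℝ} (ht : 0 ≤ t) :
    ∃ (F : ℕ → SobolevSpace n k) (f : SobolevSpace n k), (∀ j, toL2 (F j) = w j t) ∧
      toL2 f = u t ∧ Tendsto F atTop (𝓝 f) := by
  obtain ⟨W, U, h1, h2, h3, h4, h5⟩ := h
  exact ⟨fun j => W j t, U t, fun j => h1 j t ht, h2 t ht, (h5 t).tendsto_at ⟨ht, le_rfl⟩⟩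

theorem tendsto (h : ConvergesIn k w u) {t : ℝ} (ht : 0 ≤ t) :
    Tendsto (fun j => w j t) atTop (𝓝 (u t)) := by
  obtain ⟨F, f, h1, h2, h3⟩ := h.tendsto_sobolev ht
  rw [← h2]
  simpa only [← h1] using! (toL2CLM.continuous.tendsto f).comp h3

theorem tendsto_derivNorm (h : ConvergesIn k w u) {ℓ : ℕ} (hℓ : ℓ ≤ k) {t : ℝ} (ht : 0 ≤ t) :
    Tendsto (fun j => derivNorm ℓ (w j t)) atTop (𝓝 (derivNorm ℓ (u t))) := by
  obtain ⟨F, f, h1, h2, h3⟩ := h.tendsto_sobolev ht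
  rw [← h2]
  simpa only [← h1] using! ((continuous_derivNorm hℓ).tendsto f).comp h3

theorem congr {u' : ℝ → L2 n} (h : ConvergesIn k w u) (hu : ∀ t, 0 ≤ t → u t = u' t) :
    ConvergesIn k w u' := by
  obtain ⟨W, U, h1, h2, h3⟩ := h
  exact ⟨W, U, h1, fun t ht => (h2 t ht).trans (hu t ht), h3⟩

theorem sub {w' : ℕ → ℝ → L2 n} {u' : ℝ → L2 n} (h : ConvergesIn k w u)
    (h' : ConvergesIn k w' u') :
    ConvergesIn k (fun j t => w j t - w' j t) fun t => u t - u' t := by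
  obtain ⟨W, U, h1, h2, h3, h4, h5⟩ := h
  obtain ⟨W', U', h1', h2', h3', h4', h5'⟩ := h'
  exact ⟨fun j t => W j t - W' j t, fun t => U t - U' t,
    fun j t ht => by rw [map_sub, h1 j t ht, h1' j t ht],
    fun t ht => by rw [map_sub, h2 t ht, h2' t ht], fun j => (h3 j).sub (h3' j), h4.sub h4',
    fun T => (h5 T).sub (h5' T)⟩

theorem damping_smul (h : ConvergesIn k w u) (μ : ℝ) :
    ConvergesIn k (fun j t => (μ / (1 + t)) • w j t) fun t => (μ / (1 + t)) • u t := by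
  obtain ⟨W, U, h1, h2, h3, h4, h5⟩ := h
  refine ⟨fun j t => (μ / (1 + t)) • W j t, fun t => (μ / (1 + t)) • U t,
    fun j t ht => by rw [map_smul, h1 j t ht], fun t ht => by rw [map_smul, h2 t ht],
    fun j => (continuousOn_damping μ).smul (h3 j), (continuousOn_damping μ).smul h4, fun T => ?_⟩
  rw [Metric.tendstoUniformlyOn_iff]
  intro ε hε
  filter_upwards [Metric.tendstoUniformlyOn_iff.1 (h5 T) (ε / (|μ| + 1)) (by positivity)]
    with j hj t ht
  have hb : |μ / (1 + t)| ≤ |μ| := by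
    rw [abs_div]
    exact div_le_self (abs_nonneg _) (by rw [abs_of_nonneg] <;> linarith [ht.1])
  rw [dist_eq_norm, ← smul_sub, norm_smul, Real.norm_eq_abs, ← dist_eq_norm]
  calc _ ≤ |μ| * dist (U t) (W j t) := by gcongr
    _ ≤ |μ| * (ε / (|μ| + 1)) := by gcongr; exact (hj t ht).le
    _ < ε := by
      rw [mul_div_assoc', div_lt_iff₀ (by positivity)]
      nlinarith

theorem hasDtIn {z : ℕ → ℝ → L2 n} {v : ℝ → L2 n} (h : ConvergesIn k w u)
    (h' : ConvergesIn k z v) (hd : ∀ j, HasDtIn k (w j) (z j)) : HasDtIn k u v := by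
  obtain ⟨W, U, h1, h2, h3, h4, h5⟩ := h
  obtain ⟨Z, V, h1', h2', h3', h4', h5'⟩ := h'
  refine ⟨U, V, h4', fun t ht => ⟨?_, h2 t ht, h2' t ht⟩⟩
  refine hasDerivWithinAt_of_limit (fun j s hs => ?_) h3' h4'
    (fun s hs => (h5 s).tendsto_at ⟨hs, le_rfl⟩) h5' ht
  obtain ⟨A, B, hB, hAB⟩ := hd j
  have e : ∀ r, 0 ≤ r → W j r = A r := fun r hr =>
    toL2_injective ((h1 j r hr).trans (hAB r hr).2.1.symm)
  have e' : Z j s = B s := toL2_injective ((h1' j s hs).trans (hAB s hs).2.2.symm)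
  rw [e']
  exact (hAB s hs).1.congr (fun r hr => e r hr) (e s hs)

end ConvergesIn

theorem exists_convergesIn {k : ℕ} {w : ℕ → ℝ → L2 n} (hw : ∀ j, InC 0 k (w j))
    (hC : ∀ T, ∀ ε > 0, ∃ N, ∀ i ≥ N, ∀ j ≥ N, ∀ t ∈ Icc 0 T, sobolevNorm k (w i t - w j t) < ε) :
    ∃ u, ConvergesIn k w u := by
  choose W hW h using fun j => inC_zero_iff.1 (hw j)
  obtain ⟨U, hU, hUT⟩ := exists_continuousOn_limit hW fun T => by
    rw [Metric.uniformCauchySeqOn_iff]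
    intro ε hε
    obtain ⟨N, hN⟩ := hC T ε hε
    refine ⟨N, fun i hi j hj t ht => ?_⟩
    rw [dist_eq_norm, norm_def, map_sub, h i t ht.1, h j t ht.1]
    exact hN i hi j hj t ht
  exact ⟨fun t => toL2 (U t), W, U, h, fun _ _ => rfl, hW, hU, hUT⟩

/-- Solutions whose data converge in `H^{k+1} × H^k` converge. -/
theorem exists_convergesIn_of_data {μ : ℝ} (hμ : 0 < μ) {k : ℕ} {w z : ℕ → ℝ → L2 n}
    (h : ∀ j, IsRegularSolution μ k (w j) (z j)) {u₀ u₁ : L2 n} (h₀ : u₀ ∈ sobolev n (k + 1))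
    (h₁ : u₁ ∈ sobolev n k)
    (hw : Tendsto (fun j => sobolevNorm (k + 1) (w j 0 - u₀)) atTop (𝓝 0))
    (hz : Tendsto (fun j => sobolevNorm k (z j 0 - u₁)) atTop (𝓝 0)) :
    ∃ u v, ConvergesIn (k + 1) w u ∧ ConvergesIn k z v := by
  have hw0 : ∀ j, w j 0 ∈ sobolev n (k + 1) := fun j => sobolev_succ_le _ ((h j).cont.mem le_rfl)
  have hz0 : ∀ j, z j 0 ∈ sobolev n k := fun j => (h j).hasDt_dt.inC_left.mem le_rfl
  have key : ∀ T, ∀ ε > 0, ∃ N, ∀ i ≥ N, ∀ j ≥ N, ∀ t ∈ Icc 0 T,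
      sobolevNorm (k + 1) (w i t - w j t) + sobolevNorm k (z i t - z j t) < ε := by
    intro T ε hε
    obtain ⟨C, hC, hb⟩ := exists_sobolevNorm_bound hμ n k T
    have hs := hw.add hz
    rw [add_zero] at hs
    -- The factor 2 pays for comparing both solutions with the limiting data; C + 1 avoids division
    -- by zero.
    obtain ⟨N, hN⟩ := eventually_atTop.1
      (hs.eventually (gt_mem_nhds (show 0 < ε / (2 * (C + 1)) by positivity)))
    refine ⟨N, fun i hi j hj t ht => (hb _ _ ((h i).sub (h j)) t ht).trans_lt ?_⟩
    have a1 := sobolevNorm_sub_le (hw0 i) h₀ (hw0 j)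
    have a2 := sobolevNorm_sub_le (hz0 i) h₁ (hz0 j)
    rw [sobolevNorm_sub_comm h₀ (hw0 j)] at a1
    rw [sobolevNorm_sub_comm h₁ (hz0 j)] at a2
    calc _ ≤ C * (2 * (ε / (2 * (C + 1)))) := by
          gcongr; linarith [hN i hi, hN j hj]
      _ < ε := by
          rw [mul_div_assoc', mul_div_assoc', div_lt_iff₀ (by positivity)]
          nlinarith
  obtain ⟨u, hu⟩ := exists_convergesIn (k := k + 1)
    (fun j => (h j).hasDt.inC_left) fun T ε hε => by
      obtain ⟨N, hN⟩ := key T ε hε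
      exact ⟨N, fun i hi j hj t ht => lt_of_le_of_lt
        (le_add_of_nonneg_right (sobolevNorm_nonneg _ _)) (hN i hi j hj t ht)⟩
  obtain ⟨v, hv⟩ := exists_convergesIn (k := k)
    (fun j => (h j).hasDt_dt.inC_left) fun T ε hε => by
      obtain ⟨N, hN⟩ := key T ε hε
      exact ⟨N, fun i hi j hj t ht => lt_of_le_of_lt
        (le_add_of_nonneg_left (sobolevNorm_nonneg _ _)) (hN i hi j hj t ht)⟩
  exact ⟨u, v, hu, hv⟩

/-- No convergence of the second time derivatives is assumed: the equation expresses them through u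
and v, which converge in strong enough norms. -/
theorem IsRegularSolution.of_convergesIn {μ : ℝ} {k : ℕ} {w z : ℕ → ℝ → L2 n} {u v : ℝ → L2 n}
    (h : ∀ j, IsRegularSolution μ k (w j) (z j)) (hu : ConvergesIn (k + 2) w u)
    (hv : ConvergesIn (k + 1) z v) : IsRegularSolution μ k u v where
  cont := hu.inC
  hasDt := (hu.map incl (op := id) fun _ => rfl).hasDtIn hv fun j => (h j).hasDt
  hasDt_dt := (hv.map incl (op := id) fun _ => rfl).hasDtIn
    ((hu.map lap toL2_lap).sub ((hv.map incl (op := id) fun _ => rfl).damping_smul μ))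
    fun j => (h j).hasDt_dt

/-! ### Second and third order decay for smooth solutions. -/

/-- Integrating by parts twice, ⟨∂ᵢ∂ᵢf, ∂ⱼ∂ⱼf⟩ = ‖∂ⱼ∂ᵢf‖². The intermediate term contains three
derivatives of f, hence H³. -/
theorem norm_laplacian_sq_le {f : L2 n} (hf : f ∈ sobolev n 3) :
    ‖laplacian f‖ ^ 2 ≤ derivNorm 2 f ^ 2 := by
  have hd : ∀ i, weakDeriv i f ∈ sobolev n 2 := fun i => weakDeriv_mem_sobolev hf i
  have hdd : ∀ i j, weakDeriv i (weakDeriv j f) ∈ sobolev n 1 := fun i j =>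
    weakDeriv_mem_sobolev (hd j) i
  rw [derivNorm_succ_sq, ← real_inner_self_eq_norm_sq]
  simp only [derivNorm_one_sq]
  rw [laplacian, sum_inner]
  refine Finset.sum_le_sum fun i _ => ?_
  rw [inner_sum]
  refine Finset.sum_le_sum fun j _ => le_of_eq ?_
  rw [(hasWeakDeriv_weakDeriv (hd i) i).inner_eq (hasWeakDeriv_weakDeriv (hdd j j) i),
    weakDeriv_comm (hd j) i j, weakDeriv_comm (sobolev_succ_le 2 hf) i j,
    ← (hasWeakDeriv_weakDeriv (hd i) j).inner_eq (hasWeakDeriv_weakDeriv (hdd j i) j),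
    real_inner_self_eq_norm_sq]

/-- The second order estimate for smooth solutions. -/
theorem IsRegularSolution.second_order_decay {μ C a : ℝ} {u v : ℝ → L2 n}
    (hE : ∀ u v : ℝ → L2 n, IsRegularSolution μ 0 u v → ∀ s t : ℝ, 0 ≤ s → s ≤ t →
      energy t (u t) (v t) ≤ C * ((1 + s) / (1 + t)) ^ a * energy s (u s) (v s)) (hC : 0 < C)
    (h : IsRegularSolution μ 1 u v) {s t : ℝ} (hs : 0 ≤ s) (hst : s ≤ t) :
    derivNorm 1 (v t) ^ 2 + ‖_root_.laplacian (u t)‖ ^ 2 ≤ C * ((1 + s) / (1 + t)) ^ a *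
      (derivNorm 1 (v s) ^ 2 + gradSobolevNorm 1 (u s) ^ 2) := by
  have ht := hs.trans hst
  have hsum := Finset.sum_le_sum fun i (_ : i ∈ Finset.univ) =>
    hE _ _ (h.weakDeriv i) s t hs hst
  rw [← Finset.mul_sum] at hsum
  simp only [energy, Finset.sum_add_distrib, ← derivNorm_one_sq, ← derivNorm_succ_sq,
    ← Finset.sum_div, one_add_one_eq_two] at hsum
  have hl := norm_laplacian_sq_le (h.cont.mem ht)
  have h0 : 0 ≤ derivNorm 1 (u t) ^ 2 / (1 + t) ^ 2 := by positivity
  -- The weight at time s is discarded, leaving the unweighted norm of ∇u(s).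
  have hdiv : derivNorm 1 (u s) ^ 2 / (1 + s) ^ 2 ≤ derivNorm 1 (u s) ^ 2 :=
    div_le_self (sq_nonneg _) (one_le_pow₀ (by linarith))
  have hpos : 0 ≤ C * ((1 + s) / (1 + t)) ^ a := by positivity
  have d1 := derivNorm_nonneg 1 (u s)
  have d2 := derivNorm_nonneg 2 (u s)
  rw [gradSobolevNorm_one]
  calc _ ≤ _ := by linarith
    _ ≤ _ := hsum
    _ ≤ _ := by
      refine mul_le_mul_of_nonneg_left ?_ hpos
      nlinarith [mul_nonneg d1 d2]

/-- The third order estimate for smooth solutions. -/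
theorem IsRegularSolution.third_order_decay {μ C a : ℝ} {u v : ℝ → L2 n}
    (hE : ∀ u v : ℝ → L2 n, IsRegularSolution μ 0 u v → ∀ s t : ℝ, 0 ≤ s → s ≤ t →
      energy t (u t) (v t) ≤ C * ((1 + s) / (1 + t)) ^ a * energy s (u s) (v s)) (hC : 0 < C)
    (h : IsRegularSolution μ 2 u v) {s t : ℝ} (hs : 0 ≤ s) (hst : s ≤ t) :
    ‖_root_.laplacian (v t)‖ ^ 2 + derivNorm 1 (_root_.laplacian (u t)) ^ 2 ≤
      C * ((1 + s) / (1 + t)) ^ a *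
        (‖_root_.laplacian (v s)‖ ^ 2 + sobolevNorm 1 (_root_.laplacian (u s)) ^ 2) := by
  have ht := hs.trans hst
  have hE' := hE _ _ h.laplacian s t hs hst
  simp only [energy] at hE'
  set f := _root_.laplacian (u s)
  have h0 : 0 ≤ ‖_root_.laplacian (u t)‖ ^ 2 / (1 + t) ^ 2 := by positivity
  have hdiv : ‖f‖ ^ 2 / (1 + s) ^ 2 ≤ ‖f‖ ^ 2 :=
    div_le_self (sq_nonneg _) (one_le_pow₀ (by linarith))
  have hpos : 0 ≤ C * ((1 + s) / (1 + t)) ^ a := by positivity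
  have d1 := derivNorm_nonneg 1 f
  rw [sobolevNorm_one]
  calc _ ≤ _ := by linarith
    _ ≤ _ := hE'
    _ ≤ _ := by
      refine mul_le_mul_of_nonneg_left ?_ hpos
      nlinarith [mul_nonneg (norm_nonneg f) d1]

/-! ### Convergence in energy and independence of the approximation. -/

theorem ConvergesIn.tendsto_sobolevNorm {k : ℕ} {w : ℕ → ℝ → L2 n} {u : ℝ → L2 n}
    (h : ConvergesIn k w u) {t : ℝ} (ht : 0 ≤ t) :
    Tendsto (fun j => sobolevNorm k (w j t)) atTop (𝓝 (sobolevNorm k (u t))) :=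
  tendsto_finsetSum _ fun _ hℓ =>
    h.tendsto_derivNorm (Nat.lt_succ_iff.1 (Finset.mem_range.1 hℓ)) ht

theorem ConvergesIn.convergesInEnergy {w z : ℕ → ℝ → L2 n} {u v : ℝ → L2 n}
    (hu : ConvergesIn 1 w u) (hv : ConvergesIn 0 z v)
    (hz : ∀ j t, 0 ≤ t → dt (w j) t = z j t) (hdu : ∀ t, 0 ≤ t → dt u t = v t) :
    ConvergesInEnergy w u := by
  intro T _
  obtain ⟨W, U, h1, h2, -, -, h5⟩ := hu
  obtain ⟨Z, V, h1', h2', -, -, h5'⟩ := hv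
  rw [Metric.tendstoUniformlyOn_iff]
  intro ε hε
  filter_upwards [Metric.tendstoUniformlyOn_iff.1 (h5 T) (ε / 2) (by positivity),
    Metric.tendstoUniformlyOn_iff.1 (h5' T) (ε / 2) (by positivity)] with j hj hj' t ht
  have a1 : sobolevNorm 1 (w j t - u t) < ε / 2 := by
    rw [← h1 j t ht.1, ← h2 t ht.1, ← map_sub, ← norm_def, ← dist_eq_norm, dist_comm]
    exact hj t ht
  have a2 : ‖dt (w j) t - dt u t‖ < ε / 2 := by
    rw [hz j t ht.1, hdu t ht.1, ← h1' j t ht.1, ← h2' t ht.1, ← map_sub, ← sobolevNorm_zero,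
      ← norm_def, ← dist_eq_norm, dist_comm]
    exact hj' t ht
  rw [Pi.zero_apply, dist_zero_left, Real.norm_of_nonneg
    (add_nonneg (sobolevNorm_nonneg _ _) (norm_nonneg _))]
  linarith

theorem ConvergesInEnergy.tendsto {w : ℕ → ℝ → L2 n} {u : ℝ → L2 n} (h : ConvergesInEnergy w u)
    {t : ℝ} (ht : 0 ≤ t) : Tendsto (fun j => w j t) atTop (𝓝 (u t)) := by
  rw [tendsto_iff_norm_sub_tendsto_zero]
  refine squeeze_zero (fun _ => norm_nonneg _) (fun j => ?_)
    ((h (t + 1) (by positivity)).tendsto_at (x := t) ⟨ht, by linarith⟩)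
  exact (norm_le_sobolevNorm 1 _).trans (le_add_of_nonneg_right (norm_nonneg _))

/-- The limit of approximate solutions does not depend on the approximation. -/
theorem IsApproximation.convergesInEnergy {μ : ℝ} (hμ : 0 < μ) {u₀ u₁ : L2 n}
    (h₀ : u₀ ∈ sobolev n 1) {w w' : ℕ → ℝ → L2 n} {u : ℝ → L2 n} (hw : IsApproximation μ u₀ u₁ w)
    (hw' : IsApproximation μ u₀ u₁ w') (hu : ConvergesInEnergy w' u) (hmem : InC 0 1 u) :
    ConvergesInEnergy w u := by
  intro T hT
  have hr := fun j => (hw.strong j).isRegularSolution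
  have hr' := fun j => (hw'.strong j).isRegularSolution
  obtain ⟨C, hC, hb⟩ := exists_sobolevNorm_bound hμ n 0 T
  have hs := ((hw.data.add hw'.data).add (hw.data_dt.add hw'.data_dt))
  simp only [add_zero] at hs
  rw [Metric.tendstoUniformlyOn_iff]
  intro ε hε
  filter_upwards [hs.eventually (gt_mem_nhds (show 0 < ε / 2 / (C + 1) by positivity)),
    Metric.tendstoUniformlyOn_iff.1 (hu T hT) (ε / 2) (by positivity)] with j hj hj' t ht
  have m1 : ∀ t, 0 ≤ t → w j t ∈ sobolev n 1 := fun t ht => (hr j).hasDt.inC_left.mem ht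
  have m2 : ∀ t, 0 ≤ t → w' j t ∈ sobolev n 1 := fun t ht => (hr' j).hasDt.inC_left.mem ht
  have a1 := sobolevNorm_sub_le (m1 0 le_rfl) h₀ (m2 0 le_rfl)
  rw [sobolevNorm_sub_comm h₀ (m2 0 le_rfl)] at a1
  have a2 := norm_sub_le_norm_sub_add_norm_sub (dt (w j) 0) u₁ (dt (w' j) 0)
  rw [norm_sub_rev u₁] at a2
  -- By linearity the difference of the two strong solutions is a solution, controlled by the
  -- difference of their data.
  have b := hb _ _ ((hr j).sub (hr' j)) t ht
  simp only [zero_add, sobolevNorm_zero] at b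
  have hj'' := hj' t ht
  rw [Pi.zero_apply, dist_zero_left, Real.norm_of_nonneg
    (add_nonneg (sobolevNorm_nonneg _ _) (norm_nonneg _))] at hj'' ⊢
  have c1 := sobolevNorm_sub_le (m1 t ht.1) (m2 t ht.1) (hmem.mem ht.1)
  have c2 := norm_sub_le_norm_sub_add_norm_sub (dt (w j) t) (dt (w' j) t) (dt u t)
  have d : C * (sobolevNorm 1 (w j 0 - w' j 0) + ‖dt (w j) 0 - dt (w' j) 0‖) ≤ ε / 2 := by
    calc _ ≤ C * (ε / 2 / (C + 1)) := by gcongr; linarith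
      _ ≤ ε / 2 := by
        rw [mul_div_assoc', div_le_iff₀ (by positivity)]
        nlinarith
  linarith

end

/-! ### The main theorem. -/

theorem proposition2p1 (μ η : ℝ) (hμ : 0 < μ) (hη₀ : 0 < η) (hη₂ : η < 2) :
    ∃ C : ℝ, 0 < C ∧ ∀ n : ℕ, 1 ≤ n → ∀ u₀ u₁ : L2 n, u₀ ∈ sobolev n 1 →
      ∃ u : ℝ → L2 n,
        IsMildSolution μ u₀ u₁ u ∧
        (∀ v : ℝ → L2 n, IsMildSolution μ u₀ u₁ v → EqOn v u (Ici 0)) ∧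
        (∀ w : ℕ → ℝ → L2 n, IsApproximation μ u₀ u₁ w → ConvergesInEnergy w u) ∧
        (∀ s t : ℝ, 0 ≤ s → s ≤ t →
          ‖u t‖ ^ 2 / (1 + t) ^ 2 + ‖dt u t‖ ^ 2 + derivNorm 1 (u t) ^ 2 ≤
            C * ((1 + s) / (1 + t)) ^ alpha0 μ η *
              (‖u s‖ ^ 2 / (1 + s) ^ 2 + ‖dt u s‖ ^ 2 + derivNorm 1 (u s) ^ 2)) ∧
        (u₀ ∈ sobolev n 2 → u₁ ∈ sobolev n 1 →
          IsStrongSolution μ u₀ u₁ u ∧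
          ∀ s t : ℝ, 0 ≤ s → s ≤ t →
            derivNorm 1 (dt u t) ^ 2 + ‖laplacian (u t)‖ ^ 2 ≤
              C * ((1 + s) / (1 + t)) ^ alpha0 μ η *
                (derivNorm 1 (dt u s) ^ 2 + gradSobolevNorm 1 (u s) ^ 2)) ∧
        (u₀ ∈ sobolev n 3 → u₁ ∈ sobolev n 2 →
          InC 0 3 u ∧ InC 1 2 u ∧
          ∀ s t : ℝ, 0 ≤ s → s ≤ t →
            ‖dt (fun τ => laplacian (u τ)) t‖ ^ 2 + derivNorm 1 (laplacian (u t)) ^ 2 ≤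
              C * ((1 + s) / (1 + t)) ^ alpha0 μ η *
                (‖dt (fun τ => laplacian (u τ)) s‖ ^ 2 +
                  sobolevNorm 1 (laplacian (u s)) ^ 2)) := by
  obtain ⟨C, hC, hE⟩ := exists_energy_decay hμ hη₀ hη₂
  refine ⟨C, hC, fun n _ u₀ u₁ h₀ => ?_⟩
  choose w z hreg hw0 hz0 using fun R => exists_isRegularSolution_bandProj μ R u₀ u₁
  have hlim : ∀ k, u₀ ∈ sobolev n (k + 1) → u₁ ∈ sobolev n k →
      ∃ u v, ConvergesIn (k + 1) w u ∧ ConvergesIn k z v := fun k hk hk' =>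
    exists_convergesIn_of_data hμ (fun j => hreg j k) hk hk'
      (by simpa only [hw0] using tendsto_sobolevNorm_bandProj hk)
      (by simpa only [hz0] using tendsto_sobolevNorm_bandProj hk')
  obtain ⟨u, v, hu, hv⟩ := hlim 0 h₀ Submodule.mem_top
  -- One sequence serves every order of regularity: its limits in the stronger norms agree with u
  -- and v, since L² limits are unique.
  have hlim' : ∀ k, u₀ ∈ sobolev n (k + 1) → u₁ ∈ sobolev n k →
      ConvergesIn (k + 1) w u ∧ ConvergesIn k z v := fun k hk hk' => by
    obtain ⟨u', v', hu', hv'⟩ := hlim k hk hk'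
    exact ⟨hu'.congr fun t ht => tendsto_nhds_unique (hu'.tendsto ht) (hu.tendsto ht),
      hv'.congr fun t ht => tendsto_nhds_unique (hv'.tendsto ht) (hv.tendsto ht)⟩
  have hdz : ∀ j t, 0 ≤ t → dt (w j) t = z j t := fun j t ht => (hreg j 0).hasDt.dt_eq ht
  have huv : HasDtIn 0 u v := (hu.map SobolevSpace.incl (op := id) fun _ => rfl).hasDtIn hv fun j =>
    (hreg j 0).hasDt.map SobolevSpace.incl (op := id) fun _ => rfl
  have hdu : ∀ t, 0 ≤ t → dt u t = v t := fun t ht => huv.dt_eq ht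
  have happ : IsApproximation μ u₀ u₁ w :=
    { strong := fun j => by
        rw [hdz j 0 le_rfl]
        exact (hreg j 0).isStrongSolution
      data := by simpa only [hw0] using tendsto_sobolevNorm_bandProj h₀
      data_dt := by
        simp only [hdz _ 0 le_rfl, hz0]
        exact tendsto_iff_norm_sub_tendsto_zero.1 (tendsto_bandProj u₁) }
  have hconv : ConvergesInEnergy w u := hu.convergesInEnergy hv hdz hdu
  have hinit : u 0 = u₀ := tendsto_nhds_unique (hu.tendsto le_rfl)
    (by simpa only [hw0] using tendsto_bandProj u₀)
  have hinit' : v 0 = u₁ := tendsto_nhds_unique (hv.tendsto le_rfl)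
    (by simpa only [hz0] using tendsto_bandProj u₁)
  have hall : ∀ w : ℕ → ℝ → L2 n, IsApproximation μ u₀ u₁ w → ConvergesInEnergy w u :=
    fun w' hw' => hw'.convergesInEnergy hμ h₀ happ hconv hu.inC
  refine ⟨u, ⟨h₀, hu.inC, huv.inC_one, w, happ, hconv⟩, fun u' hu' t ht => ?_, hall,
    fun s t hs hst => ?_, fun h₂ h₁ => ⟨?_, fun s t hs hst => ?_⟩,
    fun h₃ h₂ => ?_⟩
  · obtain ⟨w', hw', hc⟩ := hu'.limit
    exact tendsto_nhds_unique (hc.tendsto ht) ((hall w' hw').tendsto ht)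
  · have ht := hs.trans hst
    have lim : ∀ r, 0 ≤ r → Tendsto (fun j => energy r (w j r) (z j r)) atTop
        (𝓝 (energy r (u r) (v r))) := fun r hr =>
      ((((hu.tendsto hr).norm.pow 2).div_const _).add ((hv.tendsto hr).norm.pow 2)).add
        ((hu.tendsto_derivNorm le_rfl hr).pow 2)
    rw [hdu t ht, hdu s hs]
    exact le_of_tendsto_of_tendsto' (lim t ht) ((lim s hs).const_mul _) fun j =>
      hE n _ _ (hreg j 0) s t hs hst
  · obtain ⟨hu2, hv1⟩ := hlim' 1 h₂ h₁
    have := (IsRegularSolution.of_convergesIn (fun j => hreg j 0) hu2 hv1).isStrongSolution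
    rwa [hinit, hinit'] at this
  · obtain ⟨hu2, hv1⟩ := hlim' 1 h₂ h₁
    have ht := hs.trans hst
    rw [hdu t ht, hdu s hs]
    -- The estimate is taken for the band-limited solutions, which have the extra derivative its
    -- proof needs; the limit involves only norms controlled by H² × H¹.
    refine le_of_tendsto_of_tendsto'
      (((hv1.tendsto_derivNorm le_rfl ht).pow 2).add
        (((hu2.map (j := 0) SobolevSpace.lap SobolevSpace.toL2_lap).tendsto ht).norm.pow 2))
      ((((hv1.tendsto_derivNorm le_rfl hs).pow 2).add (Tendsto.pow ?_ 2)).const_mul _)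
      fun j => (hreg j 1).second_order_decay (hE n) hC hs hst
    exact tendsto_finsetSum _ fun ℓ hℓ => hu2.tendsto_derivNorm
      (Nat.succ_le_succ (Nat.lt_succ_iff.1 (Finset.mem_range.1 hℓ))) hs
  · obtain ⟨hu3, hv2⟩ := hlim' 2 h₃ h₂
    have hd : HasDtIn 2 u v := (hu3.map SobolevSpace.incl (op := id) fun _ => rfl).hasDtIn hv2 fun j =>
      (hreg j 1).hasDt
    refine ⟨hu3.inC, hd.inC_one, fun s t hs hst => ?_⟩
    have ht := hs.trans hst
    have hlap : HasDtIn 0 (fun t => laplacian (u t)) fun t => laplacian (v t) :=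
      hd.map SobolevSpace.lap SobolevSpace.toL2_lap
    have hl : ConvergesIn 1 (fun j t => laplacian (w j t)) fun t => laplacian (u t) :=
      hu3.map SobolevSpace.lap SobolevSpace.toL2_lap
    have hl' : ConvergesIn 0 (fun j t => laplacian (z j t)) fun t => laplacian (v t) :=
      hv2.map SobolevSpace.lap SobolevSpace.toL2_lap
    rw [hlap.dt_eq ht, hlap.dt_eq hs]
    exact le_of_tendsto_of_tendsto'
      (((hl'.tendsto ht).norm.pow 2).add ((hl.tendsto_derivNorm le_rfl ht).pow 2))
      ((((hl'.tendsto hs).norm.pow 2).add ((hl.tendsto_sobolevNorm hs).pow 2)).const_mul _)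
      fun j => (hreg j 2).third_order_decay (hE n) hC hs hst
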